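/- All graphs are finite and simple. For a graph $G$, $e(G)$ is its number of edges, $\delta(G)$ and $\Delta(G)$ its minimum and maximum degree, and $\gcd(G)$ is the greatest common divisor of its vertex degrees (with $\gcd(G)=0$, which is divisible by every integer, if $G$ has no edges). For a partition $\mathcal P$ of $V(G)$, $G[\mathcal P]$ is the spanning subgraph of $G$ consisting of the edges whose ends lie in different parts, and $G[U]$ is the subgraph induced by $U\subseteq V(G)$. A graph $G$ is $F$-divisible if $e(F)\mid e(G)$ and $\gcd(F)\mid\gcd(G)$; it has an $F$-decomposition if its edge set can be covered by pairwise edge-disjoint subgraphs of $G$, each isomorphic to $F$. Lemma 7.1. There is a function $n_0:\mathbb N\to\mathbb N$ such that for all integers $r,f\ge 1$ and every real $\varepsilon>0$ there is an $m_0$ such that the following holds for all integers $m\ge m_0$ and $n\ge n_0(m)$ (in short, $1/n\ll 1/m\ll 1/r,1/f,\varepsilon$). Let $\delta:=1-\frac{1}{3r}+\varepsilon$ and $q:=\lceil n/m\rceil$. Let $F$ be an $r$-regular graph on $f$ vertices, let $G$ be a graph on $n$ vertices, and let $\mathcal P=\{V_1,\dots,V_q\}$ be an equitable partition of $V(G)$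 with $|V_i|\in\{m,m-1\}$ for each $1\le i\le q$. Suppose that $\delta(G[\mathcal P])\ge\delta n$ and $\delta(G[V_i])\ge\delta|V_i|$ for each $1\le i\le q$. Then $G$ contains an $F$-divisible subgraph $A^*$ such that (i) $\Delta(A^*[\mathcal P])\le\varepsilon^2 n$ and $\Delta(A^*[V_i])\le r$ for each $1\le i\le q$; and (ii) if $H^*$ is an $F$-divisible graph on $V(G)$ that is edge-disjoint from $A^*$ and satisfies $e(H^*[\mathcal P])=0$, then $A^*\cup H^*$ has an $F$-decomposition. -/

import Mathlib

open scoped Classical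

namespace GraphDecomp

/-- `gcd(G)`: the greatest common divisor of the degrees of the vertices of `G`
(it is `0` if `G` has no edges, so that every integer divides it). -/
noncomputable def degreeGcd {V : Type*} [Fintype V] (G : SimpleGraph V) : ℕ :=
  Finset.univ.gcd fun v => G.degree v

/-- `G` is `F`-divisible: `e(F)` divides `e(G)` and `gcd(F)` divides `gcd(G)`. -/
def IsDivisible {W V : Type*} [Fintype W] [Fintype V]
    (F : SimpleGraph W) (G : SimpleGraph V) : Prop :=
  F.edgeFinset.card ∣ G.edgeFinset.card ∧ degreeGcd F ∣ degreeGcd G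

/-- `G` has an `F`-decomposition: there is a collection of pairwise edge-disjoint subgraphs of `G`,
each isomorphic to `F`, that together cover all the edges of `G`. -/
def HasDecomposition {W V : Type*} (F : SimpleGraph W) (G : SimpleGraph V) : Prop :=
  ∃ D : Set G.Subgraph,
    (∀ K ∈ D, Nonempty (F ≃g K.coe)) ∧
    (∀ K ∈ D, ∀ L ∈ D, K ≠ L → Disjoint K.edgeSet L.edgeSet) ∧
    (⋃ K ∈ D, K.edgeSet) = G.edgeSet

/-- `G[P]`: the multipartite subgraph of `G` induced by the partition `P` of its vertex set. It has
all the vertices of `G`, and those edges of `G` whose ends lie in different parts of `P`. -/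
def crossing {V : Type*} [Fintype V] (P : Finpartition (Finset.univ : Finset V))
    (G : SimpleGraph V) : SimpleGraph V where
  Adj u v := G.Adj u v ∧ P.part u ≠ P.part v
  symm := ⟨fun _ _ h => ⟨h.1.symm, h.2.symm⟩⟩
  loopless := ⟨fun _ h => h.2 rfl⟩

end GraphDecomp

/-! The graph `A` is built inside `G[P]`, so it has no edge inside a part, whereas `H` lives inside
the parts. A part has at most `m` vertices, so the number of graphs that `H` may induce on it is
bounded in terms of `m`. For each part and each possibility, `A` contains in advance an absorber: a
set `T` of edges such that both `T` and `T + X` decompose into copies of `F`, where `X` is what has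
to be absorbed. Once `H` is known, one absorber per part is used with its `X`, and every other
absorber is decomposed on its own.

An absorber exists only if the degrees in `X` are divisible by `r` and `e(F)` divides the size of
`X`. The first condition passes from `H` to its parts; the second does not. By the handshake lemma
the number of edges of `H` in a part is still a multiple of `g`, where `g` is `r / 2` or `r`
according to the parity of `r`. Carriers repair the rest. These are `r`-divisible graphs whose
number of edges is `g` modulo `e(F)`, and `d = e(F) / g` of them lie between consecutive parts. Each
bundle is shared out between its two neighbouring parts so that every part receives a total
divisible by `e(F)`. The surplus travels from part to part and vanishes at the end because `e(F)`
divides `e(H)` (`add_mem_decomposable`).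

Absorbers come from a calculus of multisets of edges, in which `P` and `Q` are exchangeable if some
fresh `T` makes both `T + P` and `T + Q` sums of copies of `F`. Exchanges add up, and fresh edges
occurring on both sides can be cancelled. Two copies of `F` that differ in one vertex re-centre a
cone (`convertible_cone`); a grid of cones re-centres a bare star (`convertible_star`); two stars
switch a pair of edges (`convertible_switch`). With switches and stars, all edges of `X` are
detached from their ends and reattached to one new vertex `p`. The resulting spokes depend only on
the number of edges of `X`, and a copy of `F` yields the same spokes, so they can be traded for
edges already in the catalyst (`convertible_absorber`).

Everything is embedded greedily. By the degree condition on `G[P]`, any `3 * r` vertices have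
linearly many common neighbours, even after few edges at each vertex are deleted. New vertices are
taken where few edges have been used, which keeps the degrees of `A` small
(`exists_edgeDisjoint_family`). -/

namespace GraphDecomp

/-! ### Exchanging multisets of edges, and greedy embedding -/

section Calculus

variable {W V : Type*} [Fintype W]

/-- The edges of the image of `F` under a map of its vertices, as a multiset. -/
noncomputable def copyEdges (F : SimpleGraph W) (φ : W → V) : Multiset (Sym2 V) :=
  F.edgeFinset.val.map (Sym2.map φ)

/-- The multisets of edges that are sums of copies of `F`. -/
noncomputable def decomposable (F : SimpleGraph W) (V : Type*) :
    AddSubmonoid (Multiset (Sym2 V)) :=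
  AddSubmonoid.closure {M | ∃ φ : W → V, Function.Injective φ ∧ M = copyEdges F φ}

theorem copyEdges_mem_decomposable (F : SimpleGraph W) {φ : W → V} (hφ : Function.Injective φ) :
    copyEdges F φ ∈ decomposable F V :=
  AddSubmonoid.subset_closure ⟨φ, hφ, rfl⟩

theorem copyEdges_nodup (F : SimpleGraph W) {φ : W → V} (hφ : Function.Injective φ) :
    (copyEdges F φ).Nodup :=
  F.edgeFinset.nodup.map (Sym2.map.injective hφ)

theorem mem_copyEdges {F : SimpleGraph W} {φ : W → V} {e : Sym2 V} :
    e ∈ copyEdges F φ ↔ ∃ a b, F.Adj a b ∧ e = s(φ a, φ b) := by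
  constructor
  · intro h
    obtain ⟨d, hd, rfl⟩ := Multiset.mem_map.1 h
    induction d with
    | _ a b =>
      refine ⟨a, b, ?_, rfl⟩
      simpa using hd
  · rintro ⟨a, b, h, rfl⟩
    exact Multiset.mem_map.2 ⟨s(a, b), by simpa using h, rfl⟩

/-- Every set of at most `k` vertices has a common neighbour outside any set of fewer than `b`
vertices. -/
def HasCommonNeighbors (G : SimpleGraph V) (k b : ℕ) : Prop :=
  ∀ S B : Finset V, S.card ≤ k → B.card < b → ∃ w, w ∉ B ∧ ∀ s ∈ S, G.Adj s w

/-- `T` is a set of edges of `G` on the vertices in `R ∪ N`, each of which has an end in `N`. -/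
structure Fresh (G : SimpleGraph V) (R N : Finset V) (T : Multiset (Sym2 V)) : Prop where
  nodup : T.Nodup
  mem_edgeSet : ∀ e ∈ T, e ∈ G.edgeSet
  exists_new : ∀ e ∈ T, ∃ w ∈ e, w ∈ N
  subset : ∀ e ∈ T, ∀ w ∈ e, w ∈ R ∨ w ∈ N

/-- The edge multisets `P` and `Q` on the roots `R` can be exchanged: with the help of at most `k`
new vertices, there are new edges `T` such that both `T + P` and `T + Q` decompose. -/
def Convertible (F : SimpleGraph W) (G : SimpleGraph V) (b : ℕ) (R : Finset V) (k : ℕ)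
    (P Q : Multiset (Sym2 V)) : Prop :=
  ∀ B : Finset V, R ⊆ B → B.card + k ≤ b → ∃ (N : Finset V) (T : Multiset (Sym2 V)),
    Disjoint N B ∧ N.card ≤ k ∧ Fresh G R N T ∧ T + P ∈ decomposable F V ∧
      T + Q ∈ decomposable F V

/-- Each edge of `T₂` has an end in `N₂`, and `N₂` misses every vertex used by `T₁`. Freshness alone
therefore rules out repeated edges. -/
theorem Fresh.add {G : SimpleGraph V} {R R' N₁ N₂ : Finset V} {T₁ T₂ : Multiset (Sym2 V)}
    (h₁ : Fresh G R N₁ T₁) (h₂ : Fresh G R' N₂ T₂) (hR : R' ⊆ R ∪ N₁)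
    (hd : Disjoint N₂ (R ∪ N₁)) : Fresh G R (N₁ ∪ N₂) (T₁ + T₂) where
  nodup := by
    refine Multiset.nodup_add.2 ⟨h₁.nodup, h₂.nodup, ?_⟩
    rw [Multiset.disjoint_left]
    intro e he he'
    obtain ⟨w, hw, hwN⟩ := h₂.exists_new e he'
    exact Finset.disjoint_left.1 hd hwN (Finset.mem_union.2 (h₁.subset e he w hw))
  mem_edgeSet e he := by
    rcases Multiset.mem_add.1 he with he | he
    exacts [h₁.mem_edgeSet e he, h₂.mem_edgeSet e he]
  exists_new e he := by
    rcases Multiset.mem_add.1 he with he | he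
    · obtain ⟨w, hw, hN⟩ := h₁.exists_new e he
      exact ⟨w, hw, Finset.mem_union_left _ hN⟩
    · obtain ⟨w, hw, hN⟩ := h₂.exists_new e he
      exact ⟨w, hw, Finset.mem_union_right _ hN⟩
  subset e he w hw := by
    rcases Multiset.mem_add.1 he with he | he
    · rcases h₁.subset e he w hw with h | h
      exacts [Or.inl h, Or.inr (Finset.mem_union_left _ h)]
    · rcases h₂.subset e he w hw with h | h
      · rcases Finset.mem_union.1 (hR h) with h | h
        exacts [Or.inl h, Or.inr (Finset.mem_union_left _ h)]
      · exact Or.inr (Finset.mem_union_right _ h)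

theorem Fresh.zero (G : SimpleGraph V) (R N : Finset V) : Fresh G R N 0 :=
  ⟨Multiset.nodup_zero, by simp, by simp, by simp⟩

namespace Convertible

variable {F : SimpleGraph W} {G : SimpleGraph V} {b k k₁ k₂ : ℕ} {R R' : Finset V}
  {P Q P₁ P₂ Q₁ Q₂ : Multiset (Sym2 V)}

theorem zero : Convertible F G b R 0 0 0 := fun _ _ _ =>
  ⟨∅, 0, by simp, by simp, Fresh.zero _ _ _, by simp, by simp⟩

theorem symm (h : Convertible F G b R k P Q) : Convertible F G b R k Q P := fun B hB hk =>
  let ⟨N, T, h₁, h₂, h₃, h₄, h₅⟩ := h B hB hk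
  ⟨N, T, h₁, h₂, h₃, h₅, h₄⟩

theorem mono (h : Convertible F G b R k₁ P Q) (hR : R ⊆ R') (hk : k₁ ≤ k₂) :
    Convertible F G b R' k₂ P Q := fun B hB hB' => by
  obtain ⟨N, T, h₁, h₂, h₃, h₄, h₅⟩ := h B (hR.trans hB) (by omega)
  exact ⟨N, T, h₁, h₂.trans hk, ⟨h₃.nodup, h₃.mem_edgeSet, h₃.exists_new,
    fun e he w hw => (h₃.subset e he w hw).imp (fun h => hR h) id⟩, h₄, h₅⟩

/-- The second exchange is made to avoid the new vertices of the first. Addition also replaces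
transitivity: exchanges of `P` with `Q` and of `Q` with `S` add up to one of `P + Q` with `Q + S`,
from which `of_fresh` removes `Q` when it consists of fresh edges. -/
theorem add (h₁ : Convertible F G b R k₁ P₁ Q₁) (h₂ : Convertible F G b R k₂ P₂ Q₂) :
    Convertible F G b R (k₁ + k₂) (P₁ + P₂) (Q₁ + Q₂) := fun B hB hk => by
  obtain ⟨N₁, T₁, hd₁, hc₁, hf₁, hP₁, hQ₁⟩ := h₁ B hB (by omega)
  obtain ⟨N₂, T₂, hd₂, hc₂, hf₂, hP₂, hQ₂⟩ := h₂ (B ∪ N₁) (hB.trans Finset.subset_union_left)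
    ((Nat.add_le_add_right (Finset.card_union_le _ _) _).trans (by omega))
  refine ⟨N₁ ∪ N₂, T₁ + T₂, Finset.disjoint_union_left.2
    ⟨hd₁, hd₂.mono_right Finset.subset_union_left⟩,
    (Finset.card_union_le _ _).trans (by omega),
    hf₁.add hf₂ Finset.subset_union_left
      (hd₂.mono_right (Finset.union_subset_union_left hB)), ?_, ?_⟩
  · rw [add_add_add_comm]; exact add_mem hP₁ hP₂
  · rw [add_add_add_comm]; exact add_mem hQ₁ hQ₂

theorem sum {ι : Type*} (s : Finset ι) {P Q : ι → Multiset (Sym2 V)}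
    (h : ∀ i ∈ s, Convertible F G b R k (P i) (Q i)) :
    Convertible F G b R (s.card * k) (∑ i ∈ s, P i) (∑ i ∈ s, Q i) := by
  induction s using Finset.induction_on with
  | empty => simpa using zero
  | insert i s hi ih =>
    rw [Finset.sum_insert hi, Finset.sum_insert hi, Finset.card_insert_of_notMem hi, add_mul,
      one_mul, add_comm (s.card * k)]
    exact (h i (Finset.mem_insert_self _ _)).add
      (ih fun j hj => h j (Finset.mem_insert_of_mem hj))

theorem add_decomposable_left (h : Convertible F G b R k P Q) {Y : Multiset (Sym2 V)}
    (hY : Y ∈ decomposable F V) : Convertible F G b R k (P + Y) Q := fun B hB hk => by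
  obtain ⟨N, T, h₁, h₂, h₃, h₄, h₅⟩ := h B hB hk
  exact ⟨N, T, h₁, h₂, h₃, by rw [← add_assoc]; exact add_mem h₄ hY, h₅⟩

/-- Additional fresh edges `I` may be used as a catalyst. -/
theorem of_fresh
    (h : ∀ B : Finset V, R ⊆ B → B.card + (k₁ + k₂) ≤ b → ∃ (N : Finset V) (I : Multiset (Sym2 V)),
      Disjoint N B ∧ N.card ≤ k₁ ∧ Fresh G R N I ∧
        Convertible F G b (R ∪ N) k₂ (P + I) (Q + I)) :
    Convertible F G b R (k₁ + k₂) P Q := fun B hB hk => by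
  obtain ⟨N₁, I, hd₁, hc₁, hf₁, hc⟩ := h B hB hk
  obtain ⟨N₂, T, hd₂, hc₂, hf₂, hP, hQ⟩ := hc (B ∪ N₁) (Finset.union_subset_union_left hB)
    ((Nat.add_le_add_right (Finset.card_union_le _ _) _).trans (by omega))
  refine ⟨N₁ ∪ N₂, I + T, Finset.disjoint_union_left.2
    ⟨hd₁, hd₂.mono_right Finset.subset_union_left⟩,
    (Finset.card_union_le _ _).trans (by omega),
    hf₁.add hf₂ subset_rfl
      (hd₂.mono_right (Finset.union_subset_union_left hB)), ?_, ?_⟩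
  · rwa [add_comm I, add_assoc, add_comm I]
  · rwa [add_comm I, add_assoc, add_comm I]

end Convertible

/-- Greedy embedding of a graph with vertex set `X`, some of whose vertices have prescribed
neighbours. -/
theorem HasCommonNeighbors.exists_embedding {G : SimpleGraph V} {k b : ℕ}
    (hG : HasCommonNeighbors G k b) {X : Type*} [Fintype X] (att : X → Finset V)
    (rel : SimpleGraph X) (hdeg : ∀ x, (att x).card + rel.degree x ≤ k) (B : Finset V)
    (hB : B.card + Fintype.card X ≤ b) :
    ∃ φ : X → V, Function.Injective φ ∧ (∀ x, φ x ∉ B) ∧ (∀ x, ∀ v ∈ att x, G.Adj v (φ x)) ∧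
      ∀ x y, rel.Adj x y → G.Adj (φ x) (φ y) := by
  suffices H : ∀ s : Finset X, ∃ φ : X → V, Set.InjOn φ s ∧ (∀ x ∈ s, φ x ∉ B) ∧
      (∀ x ∈ s, ∀ v ∈ att x, G.Adj v (φ x)) ∧
      ∀ x ∈ s, ∀ y ∈ s, rel.Adj x y → G.Adj (φ x) (φ y) by
    obtain ⟨φ, h₁, h₂, h₃, h₄⟩ := H Finset.univ
    refine ⟨φ, ?_, by simpa using h₂, by simpa using h₃, by simpa using h₄⟩
    simpa [Set.injOn_univ] using h₁
  intro s
  induction s using Finset.induction_on with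
  | empty =>
    -- Even the empty partial embedding is a total function on `X`, so unless `X` is empty some
    -- vertex of `V` is needed as a default value.
    by_cases hX : Nonempty X
    · obtain ⟨x⟩ := hX
      obtain ⟨w, -⟩ := hG ∅ B (by simp) (by have := Fintype.card_pos_iff.2 ⟨x⟩; omega)
      exact ⟨fun _ => w, by simp, by simp, by simp, by simp⟩
    · exact ⟨fun x => (hX ⟨x⟩).elim, by simp, by simp, by simp, by simp⟩
  | insert x s hx ih =>
    obtain ⟨φ, h₁, h₂, h₃, h₄⟩ := ih
    obtain ⟨w, hw, hw'⟩ := hG (att x ∪ (rel.neighborFinset x).image φ) (B ∪ s.image φ)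
      ((Finset.card_union_le _ _).trans ((Nat.add_le_add_left Finset.card_image_le _).trans
        (by simpa using hdeg x)))
      (by
        have h1 := Finset.card_union_le B (s.image φ)
        have h2 : (s.image φ).card ≤ s.card := Finset.card_image_le
        have h3 : s.card < Fintype.card X := Finset.card_lt_univ_of_notMem hx
        omega)
    have hne : ∀ y ∈ s, y ≠ x := fun y hy h => hx (h ▸ hy)
    have hwB : w ∉ B := fun h => hw (Finset.mem_union_left _ h)
    have hws : ∀ y ∈ s, φ y ≠ w := fun y hy h =>
      hw (Finset.mem_union_right _ (Finset.mem_image.2 ⟨y, hy, h⟩))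
    have hup : ∀ y ∈ s, Function.update φ x w y = φ y := fun y hy =>
      Function.update_of_ne (hne y hy) _ _
    have hadj : ∀ y, rel.Adj x y → G.Adj (φ y) w := fun y hy => hw' _ (Finset.mem_union_right _
      (Finset.mem_image.2 ⟨y, by simpa using hy, rfl⟩))
    refine ⟨Function.update φ x w, ?_, ?_, ?_, ?_⟩
    · intro y hy z hz
      rcases Finset.mem_insert.1 (Finset.mem_coe.1 hy) with rfl | hy' <;>
        rcases Finset.mem_insert.1 (Finset.mem_coe.1 hz) with rfl | hz'
      · simp
      · rw [hup z hz', Function.update_self]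
        exact fun h => (hws z hz' h.symm).elim
      · rw [hup y hy', Function.update_self]
        exact fun h => (hws y hy' h).elim
      · rw [hup y hy', hup z hz']
        exact h₁ hy' hz'
    · intro y hy
      rcases Finset.mem_insert.1 hy with rfl | hy
      · simpa using hwB
      · rw [hup y hy]; exact h₂ y hy
    · intro y hy v hv
      rcases Finset.mem_insert.1 hy with rfl | hy
      · simpa using hw' v (Finset.mem_union_left _ hv)
      · rw [hup y hy]; exact h₃ y hy v hv
    · intro y hy z hz h
      rcases Finset.mem_insert.1 hy with rfl | hy' <;>
        rcases Finset.mem_insert.1 hz with rfl | hz'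
      · exact (h.ne rfl).elim
      · rw [hup z hz', Function.update_self]
        exact (hadj z h).symm
      · rw [hup y hy', Function.update_self]
        exact hadj y h.symm
      · rw [hup y hy', hup z hz']
        exact h₄ y hy' z hz' h

theorem nodup_sum {α ι : Type*} {s : Finset ι} {f : ι → Multiset α}
    (h : ∀ i ∈ s, (f i).Nodup)
    (hd : ∀ i ∈ s, ∀ j ∈ s, ∀ a, a ∈ f i → a ∈ f j → i = j) : (∑ i ∈ s, f i).Nodup := by
  induction s using Finset.induction_on with
  | empty => simp
  | insert i s hi ih =>
    rw [Finset.sum_insert hi, Multiset.nodup_add]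
    refine ⟨h i (Finset.mem_insert_self _ _), ih (fun j hj => h j (Finset.mem_insert_of_mem hj))
      fun j hj l hl => hd j (Finset.mem_insert_of_mem hj) l (Finset.mem_insert_of_mem hl), ?_⟩
    rw [Multiset.disjoint_left]
    intro a ha ha'
    obtain ⟨j, hj, haj⟩ := Multiset.mem_sum.1 ha'
    obtain rfl := hd i (Finset.mem_insert_self _ _) j (Finset.mem_insert_of_mem hj) a ha haj
    exact hi hj

end Calculus

/-! ### Cones: re-centring one vertex of a copy of `F` -/

section Gadgets

variable {W V : Type*} [Fintype W]

/-- The star with centre `v` and the given leaves. -/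
noncomputable def starEdges {ι : Type*} [Fintype ι] (v : V) (ν : ι → V) : Multiset (Sym2 V) :=
  ∑ i, {s(v, ν i)}

theorem mem_starEdges {ι : Type*} [Fintype ι] {v : V} {ν : ι → V} {e : Sym2 V} :
    e ∈ starEdges v ν ↔ ∃ i, e = s(v, ν i) := by
  simp [starEdges, Multiset.mem_sum]

theorem starEdges_nodup {ι : Type*} [Fintype ι] {v : V} {ν : ι → V}
    (hν : Function.Injective ν) : (starEdges v ν).Nodup := by
  refine nodup_sum (fun _ _ => Multiset.nodup_singleton _) fun i _ j _ a ha ha' => hν ?_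
  rw [Multiset.mem_singleton] at ha ha'
  exact Sym2.congr_right.1 (ha.symm.trans ha')

/-- The images of the edges of `F` with an end that is neither `x` nor adjacent to `x`. -/
noncomputable def outerEdges (F : SimpleGraph W) (x : W) (α : W → V) : Multiset (Sym2 V) :=
  (F.edgeFinset.filter fun e => ∃ w ∈ e, w ≠ x ∧ ¬ F.Adj x w).val.map (Sym2.map α)

theorem copyEdges_eq_cone (F : SimpleGraph W) (x : W) (α : W → V) :
    copyEdges F α = starEdges (α x) (fun n : F.neighborSet x => α n) +
      copyEdges (F.induce (F.neighborSet x)) (fun n => α n) + outerEdges F x α := by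
  have key : F.edgeFinset.val = starEdges x (fun n : F.neighborSet x => (n : W)) +
      copyEdges (F.induce (F.neighborSet x)) (fun n => (n : W)) +
      (F.edgeFinset.filter fun e => ∃ w ∈ e, w ≠ x ∧ ¬ F.Adj x w).val := by
    have h₁ : ∀ e ∈ starEdges x (fun n : F.neighborSet x => (n : W)), x ∈ e ∧
        ∀ w ∈ e, w ≠ x → F.Adj x w := by
      intro e he
      obtain ⟨n, rfl⟩ := mem_starEdges.1 he
      refine ⟨by simp, fun w hw hwx => ?_⟩
      rcases Sym2.mem_iff.1 hw with rfl | rfl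
      exacts [(hwx rfl).elim, n.2]
    have h₂ : ∀ e ∈ copyEdges (F.induce (F.neighborSet x)) (fun n => (n : W)),
        ∀ w ∈ e, F.Adj x w := by
      intro e he w hw
      obtain ⟨a, b, -, rfl⟩ := mem_copyEdges.1 he
      rcases Sym2.mem_iff.1 hw with rfl | rfl
      exacts [a.2, b.2]
    refine (Multiset.Nodup.ext F.edgeFinset.nodup ?_).2 ?_
    · refine Multiset.nodup_add.2 ⟨Multiset.nodup_add.2 ⟨starEdges_nodup Subtype.val_injective,
        copyEdges_nodup _ Subtype.val_injective, ?_⟩, Finset.nodup _, ?_⟩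
      · rw [Multiset.disjoint_left]
        exact fun {e} he he' => (h₂ e he' x (h₁ e he).1).ne rfl
      · rw [Multiset.disjoint_left]
        intro e he he'
        obtain ⟨-, w, hw, hwx, hn⟩ := Finset.mem_filter.1 he'
        rcases Multiset.mem_add.1 he with he | he
        exacts [hn ((h₁ e he).2 w hw hwx), hn (h₂ e he w hw)]
    · intro e
      rw [Multiset.mem_add, Multiset.mem_add, Finset.mem_val, Finset.mem_val, Finset.mem_filter,
        mem_starEdges, mem_copyEdges, SimpleGraph.mem_edgeFinset]
      constructor
      · intro he
        by_cases h : ∃ w ∈ e, w ≠ x ∧ ¬ F.Adj x w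
        · exact Or.inr ⟨he, h⟩
        · left
          push Not at h
          induction e with
          | _ a b =>
            have hab : F.Adj a b := he
            by_cases ha : a = x
            · subst ha
              exact Or.inl ⟨⟨b, hab⟩, rfl⟩
            by_cases hb : b = x
            · subst hb
              exact Or.inl ⟨⟨a, hab.symm⟩, Sym2.eq_swap⟩
            exact Or.inr ⟨⟨a, h a (by simp) ha⟩, ⟨b, h b (by simp) hb⟩, hab, rfl⟩
      · rintro ((⟨n, rfl⟩ | ⟨a, b, h, rfl⟩) | ⟨h, -⟩)
        · exact n.2
        · exact h
        · exact h
  unfold copyEdges outerEdges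
  rw [key, Multiset.map_add, Multiset.map_add]
  congr 2
  · simp only [starEdges]
    rw [← Multiset.coe_mapAddMonoidHom, map_sum]
    simp
  · simp only [copyEdges, Multiset.map_map]
    refine Multiset.map_congr rfl fun e _ => ?_
    simp [Sym2.map_map]

/-- The neighbourhood of `x`, placed at the vertices `ν`, together with a star. -/
noncomputable def coneEdges (F : SimpleGraph W) (x : W) (v : V) (ν : F.neighborSet x → V) :
    Multiset (Sym2 V) :=
  starEdges v ν + copyEdges (F.induce (F.neighborSet x)) ν

/-- An edge at `x` has its other end adjacent to `x`. Hence an edge with an end outside the closed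
neighbourhood of `x` avoids `x`, and moving the image of `x` does not affect it. -/
theorem outerEdges_congr {F : SimpleGraph W} {x : W} {α β : W → V} (h : ∀ w, w ≠ x → α w = β w) :
    outerEdges F x α = outerEdges F x β := by
  refine Multiset.map_congr rfl fun e he => ?_
  obtain ⟨he, w, hw, hwx, hn⟩ := Finset.mem_filter.1 he
  rw [SimpleGraph.mem_edgeFinset] at he
  induction e with
  | _ a b =>
    have hab : F.Adj a b := he
    have ha : a ≠ x := by
      rintro rfl
      rcases Sym2.mem_iff.1 hw with rfl | rfl
      exacts [hwx rfl, hn hab]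
    have hb : b ≠ x := by
      rintro rfl
      rcases Sym2.mem_iff.1 hw with rfl | rfl
      exacts [hn hab.symm, hwx rfl]
    simp [h a ha, h b hb]

variable {F : SimpleGraph W} {G : SimpleGraph V} {b r : ℕ} {R : Finset V}

/-- The centre of a cone can be changed. -/
theorem convertible_cone (hF : F.IsRegularOfDegree r) (hG : HasCommonNeighbors G (3 * r) b)
    (x : W) {v p : V} {ν : F.neighborSet x → V} (hν : Function.Injective ν)
    (hv : v ∈ R) (hp : p ∈ R) (hνR : ∀ n, ν n ∈ R) (hvν : ∀ n, ν n ≠ v) (hpν : ∀ n, ν n ≠ p) :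
    Convertible F G b R (Fintype.card W) (coneEdges F x v ν) (coneEdges F x p ν) := by
  intro B hB hk
  -- Only the vertices outside the closed neighbourhood of `x` are embedded afresh. The same
  -- embedding completes the cone at `v` and the cone at `p` to copies of `F`.
  let X := {w : W // w ≠ x ∧ ¬ F.Adj x w}
  obtain ⟨φ, hφ, hφB, hφatt, hφrel⟩ := hG.exists_embedding (X := X)
    (fun w => (Finset.univ.filter fun n : F.neighborSet x => F.Adj w n).image ν)
    (F.comap (Subtype.val : X → W))
    (by
      intro w
      refine (add_le_add (?_ : _ ≤ r) (?_ : _ ≤ r)).trans (by omega)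
      · refine Finset.card_image_le.trans ?_
        rw [← hF.degree_eq w, ← SimpleGraph.card_neighborFinset_eq_degree]
        refine Finset.card_le_card_of_injOn (fun n => (n : W)) (fun n hn => ?_)
          Subtype.val_injective.injOn
        simpa using hn
      · rw [← hF.degree_eq w]
        convert (SimpleGraph.Embedding.comap
          (⟨Subtype.val, Subtype.val_injective⟩ : X ↪ W) F).toCopy.degree_le w
        all_goals rfl) B
    ((Nat.add_le_add_left (Fintype.card_subtype_le _) _).trans hk)
  let α : V → W → V := fun u w => if h : F.Adj x w then ν ⟨w, h⟩ else
    if h' : w ≠ x then φ ⟨w, h', h⟩ else u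
  have αN : ∀ u w (h : F.Adj x w), α u w = ν ⟨w, h⟩ := fun u w h => by simp [α, h]
  have αX : ∀ u w (h : w ≠ x) (h' : ¬ F.Adj x w), α u w = φ ⟨w, h, h'⟩ := fun u w h h' => by
    simp [α, h, h']
  have αx : ∀ u, α u x = u := fun u => by simp [α]
  have hφR : ∀ w, φ w ∉ R := fun w h => hφB w (hB h)
  have αinj : ∀ u ∈ R, (∀ n, ν n ≠ u) → Function.Injective (α u) := by
    intro u hu hun a c hac
    by_cases ha : F.Adj x a <;> by_cases hc : F.Adj x c
    · rw [αN u a ha, αN u c hc] at hac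
      exact congrArg Subtype.val (hν hac)
    · rw [αN u a ha] at hac
      by_cases hc' : c = x
      · rw [hc', αx] at hac; exact (hun _ hac).elim
      · rw [αX u c hc' hc] at hac
        exact (hφR _ (hac ▸ hνR _)).elim
    · rw [αN u c hc] at hac
      by_cases ha' : a = x
      · rw [ha', αx] at hac; exact (hun _ hac.symm).elim
      · rw [αX u a ha' ha] at hac
        exact (hφR _ (hac ▸ hνR _)).elim
    · by_cases ha' : a = x <;> by_cases hc' : c = x
      · rw [ha', hc']
      · rw [ha', αx, αX u c hc' hc] at hac
        exact (hφR _ (hac ▸ hu)).elim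
      · rw [hc', αx, αX u a ha' ha] at hac
        exact (hφR _ (hac ▸ hu)).elim
      · rw [αX u c hc' hc, αX u a ha' ha] at hac
        exact congrArg Subtype.val (hφ hac)
  have hcopy : ∀ u, outerEdges F x (α v) + coneEdges F x u ν = copyEdges F (α u) := by
    intro u
    rw [copyEdges_eq_cone F x (α u), add_comm, coneEdges, αx]
    have hN : (fun n : F.neighborSet x => α u n) = ν := funext fun n => αN u n n.2
    rw [hN]
    congr 1
    refine outerEdges_congr fun w hw => ?_
    simp [α, hw]
  refine ⟨Finset.univ.image φ, outerEdges F x (α v), ?_, ?_, ?_, ?_, ?_⟩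
  · rw [Finset.disjoint_left]
    intro u hu
    obtain ⟨w, -, rfl⟩ := Finset.mem_image.1 hu
    exact hφB w
  · exact Finset.card_image_le.trans (Fintype.card_subtype_le _)
  · have hmem : ∀ e ∈ outerEdges F x (α v), ∃ a c, F.Adj a c ∧ c ≠ x ∧
        ∃ (h : a ≠ x) (h' : ¬ F.Adj x a), e = s(φ ⟨a, h, h'⟩, α v c) := by
      intro e he
      obtain ⟨d, hd, rfl⟩ := Multiset.mem_map.1 he
      obtain ⟨hd', w, hw, hwx, hn⟩ := Finset.mem_filter.1 hd
      rw [SimpleGraph.mem_edgeFinset] at hd'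
      obtain ⟨c, rfl⟩ := hw
      refine ⟨w, c, hd', ?_, hwx, hn, ?_⟩
      · rintro rfl
        exact hn (SimpleGraph.Adj.symm hd')
      · rw [Sym2.map_mk, αX v w hwx hn]
    refine ⟨?_, ?_, ?_, ?_⟩
    · exact (Finset.nodup _).map (Sym2.map.injective (αinj v hv hvν))
    · intro e he
      obtain ⟨a, c, hac, hc, ha, ha', rfl⟩ := hmem e he
      rw [SimpleGraph.mem_edgeSet]
      by_cases hcx : F.Adj x c
      · rw [αN v c hcx]
        refine (hφatt ⟨a, ha, ha'⟩ _ (Finset.mem_image.2 ⟨⟨c, hcx⟩, ?_, rfl⟩)).symm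
        simpa using hac
      · rw [αX v c hc hcx]
        exact hφrel _ _ hac
    · intro e he
      obtain ⟨a, c, hac, hc, ha, ha', rfl⟩ := hmem e he
      exact ⟨_, Sym2.mem_mk_left _ _, Finset.mem_image_of_mem _ (Finset.mem_univ _)⟩
    · intro e he w hw
      obtain ⟨a, c, hac, hc, ha, ha', rfl⟩ := hmem e he
      rcases Sym2.mem_iff.1 hw with rfl | rfl
      · exact Or.inr (Finset.mem_image_of_mem _ (Finset.mem_univ _))
      · by_cases hcx : F.Adj x c
        · rw [αN v c hcx]
          exact Or.inl (hνR _)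
        · rw [αX v c hc hcx]
          exact Or.inr (Finset.mem_image_of_mem _ (Finset.mem_univ _))
  · rw [hcopy v]
    exact copyEdges_mem_decomposable F (αinj v hv hvν)
  · rw [hcopy p]
    exact copyEdges_mem_decomposable F (αinj p hp hpν)

end Gadgets

/-! ### Re-centring stars and switching edges -/

section Swap

variable {W V : Type*} [Fintype W] {F : SimpleGraph W} {G : SimpleGraph V} {b r : ℕ} {R : Finset V}

theorem card_neighborSet (hF : F.IsRegularOfDegree r) (x : W) :
    Fintype.card (F.neighborSet x) = r := by
  rw [SimpleGraph.card_neighborSet_eq_degree, hF.degree_eq]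

theorem card_neighborSet_ne (hF : F.IsRegularOfDegree r) {x : W} (n₀ : F.neighborSet x) :
    Nat.card {j // j ≠ n₀} + 1 = r := by
  have h := card_neighborSet hF x
  have h0 : 0 < Fintype.card (F.neighborSet x) := Fintype.card_pos_iff.2 ⟨n₀⟩
  have h1 := Fintype.card_subtype_compl (fun j => j = n₀)
  rw [Fintype.card_subtype_eq, ← Nat.card_eq_fintype_card, h] at h1
  change Nat.card {j // ¬ j = n₀} + 1 = r
  omega

/-- The centre of a star whose leaves are indexed by the neighbours of `x` can be changed. -/
theorem convertible_star (hF : F.IsRegularOfDegree r) (hG : HasCommonNeighbors G (3 * r) b)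
    {x : W} (n₀ : F.neighborSet x) {v p : V} {z : F.neighborSet x → V}
    (hz : Function.Injective z) (hv : v ∈ R) (hp : p ∈ R) (hzR : ∀ n, z n ∈ R)
    (hzv : ∀ n, z n ≠ v) (hzp : ∀ n, z n ≠ p) (hvp : v ≠ p) :
    Convertible F G b R (r * r + 2 * r * Fintype.card W) (starEdges v z) (starEdges p z) := by
  -- The vertices form a grid `g` indexed by pairs of neighbours of `x`; its column `n₀` consists of
  -- the given leaves and all other entries are new. Re-centring the cones over all rows from `v` to
  -- `p`, and those over the columns other than `n₀` from `p` back to `v`, moves in total only the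
  -- spokes to column `n₀`. The other spokes, the row edges and the column edges are the catalyst.
  -- Column `n₀` carries no column edges, so no catalyst edge joins two roots.
  refine Convertible.of_fresh fun B hB hk => ?_
  have hcard := card_neighborSet hF x
  let N := F.neighborSet x
  let H : SimpleGraph N := F.induce (F.neighborSet x)
  let M := {j : N // j ≠ n₀}
  have hM : Fintype.card M + 1 = r := by
    rw [← Nat.card_eq_fintype_card]
    exact card_neighborSet_ne hF n₀
  obtain ⟨φ, hφ, hφB, hφatt, hφrel⟩ := hG.exists_embedding (X := N × M)
    (fun q => {v, p} ∪ if H.Adj n₀ q.2 then {z q.1} else ∅)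
    (H □ H.comap (Subtype.val : M → N))
    (by
      intro q
      -- The prescribed roots are `v`, `p` and possibly the leaf of the row. A column has `r`
      -- entries and a row has `r - 1` new ones, which bounds the degrees by `r - 1` and `r - 2`.
      refine (add_le_add (?_ : _ ≤ 3) (?_ : _ ≤ (r - 1) + (r - 2))).trans
        (by have := Fintype.card_pos_iff.2 ⟨q.2⟩; omega)
      · refine (Finset.card_union_le _ _).trans
          (add_le_add Finset.card_le_two (?_ : _ ≤ 1))
        split_ifs <;> simp
      · have h1 : H.degree q.1 ≤ r - 1 := by
          have := H.degree_lt_card_verts q.1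
          change _ < Fintype.card (F.neighborSet x) at this
          rw [hcard] at this
          omega
        have h2 : (H.comap (Subtype.val : M → N)).degree q.2 ≤ r - 2 := by
          have := (H.comap (Subtype.val : M → N)).degree_lt_card_verts q.2
          rw [← Nat.card_eq_fintype_card] at this hM
          have hM' : Nat.card {j : N // j ≠ n₀} + 1 = r := hM
          omega
        refine le_trans (le_of_eq ?_) (add_le_add h1 h2)
        convert SimpleGraph.degree_boxProd q) B
    (by
      rw [Fintype.card_prod]
      change _ + Fintype.card (F.neighborSet x) * _ ≤ _
      rw [hcard]
      have : r * Fintype.card M ≤ r * r := Nat.mul_le_mul_left _ (by omega)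
      omega)
  let g : N → N → V := fun i j => if h : j = n₀ then z i else φ (i, ⟨j, h⟩)
  have g0 : ∀ i, g i n₀ = z i := fun i => by simp [g]
  have g1 : ∀ i j (h : j ≠ n₀), g i j = φ (i, ⟨j, h⟩) := fun i j h => by simp [g, h]
  have hφR : ∀ q, φ q ∉ R := fun q h => hφB q (hB h)
  have ginj : ∀ i j i' j', g i j = g i' j' → i = i' ∧ j = j' := by
    intro i j i' j' h
    by_cases hj : j = n₀ <;> by_cases hj' : j' = n₀
    · subst hj hj'
      rw [g0, g0] at h
      exact ⟨hz h, rfl⟩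
    · rw [hj, g0, g1 _ _ hj'] at h
      exact (hφR _ (h ▸ hzR i)).elim
    · rw [hj', g0, g1 _ _ hj] at h
      exact (hφR _ (h ▸ hzR i')).elim
    · rw [g1 _ _ hj, g1 _ _ hj'] at h
      have := Prod.mk.inj (hφ h)
      exact ⟨this.1, congrArg Subtype.val this.2⟩
  have grow : ∀ i, Function.Injective (g i) := fun i j j' h => (ginj _ _ _ _ h).2
  have gcol : ∀ j, Function.Injective fun i => g i j := fun j i i' h => (ginj _ _ _ _ h).1
  have gne : ∀ u ∈ R, (∀ n, z n ≠ u) → ∀ i j, g i j ≠ u := by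
    intro u hu hzu i j
    by_cases hj : j = n₀
    · rw [hj, g0]; exact hzu i
    · rw [g1 _ _ hj]; exact fun h => hφR _ (h ▸ hu)
  have gv := gne v hv hzv
  have gp := gne p hp hzp
  let N₀ : Finset V := Finset.univ.image φ
  have gN : ∀ i j, j ≠ n₀ → g i j ∈ N₀ := fun i j hj => by
    rw [g1 _ _ hj]; exact Finset.mem_image_of_mem _ (Finset.mem_univ _)
  have gRN : ∀ i j, g i j ∈ R ∨ g i j ∈ N₀ := by
    intro i j
    by_cases hj : j = n₀
    · rw [hj, g0]; exact Or.inl (hzR i)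
    · exact Or.inr (gN i j hj)
  have adjv : ∀ i j, j ≠ n₀ → G.Adj v (g i j) := fun i j hj => by
    rw [g1 _ _ hj]; exact hφatt _ _ (by simp)
  have adjp : ∀ i j, j ≠ n₀ → G.Adj p (g i j) := fun i j hj => by
    rw [g1 _ _ hj]; exact hφatt _ _ (by simp)
  have adjcol : ∀ i i' j, j ≠ n₀ → H.Adj i i' → G.Adj (g i j) (g i' j) := fun i i' j hj h => by
    rw [g1 _ _ hj, g1 _ _ hj]
    exact hφrel _ _ (by simp [SimpleGraph.boxProd_adj, h])
  have adjrow' : ∀ i j j', j' ≠ n₀ → H.Adj j j' → G.Adj (g i j) (g i j') := by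
    intro i j j' hj' h
    rw [g1 _ _ hj']
    by_cases hj : j = n₀
    · rw [hj, g0]
      exact hφatt _ _ (by simp [← hj, h])
    · rw [g1 _ _ hj]
      exact hφrel _ _ (by simp [SimpleGraph.boxProd_adj, h])
  have adjrow : ∀ i j j', H.Adj j j' → G.Adj (g i j) (g i j') := by
    intro i j j' h
    by_cases hj' : j' = n₀
    · exact (adjrow' i j' j (fun hj => h.ne (hj.trans hj'.symm)) h.symm).symm
    · exact adjrow' i j j' hj' h
  let s : Finset N := Finset.univ.erase n₀
  let St : V → Multiset (Sym2 V) := fun u => ∑ j ∈ s, starEdges u fun i => g i j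
  let Rows : Multiset (Sym2 V) := ∑ i, copyEdges H (g i)
  let Cols : Multiset (Sym2 V) := ∑ j ∈ s, copyEdges H fun i => g i j
  have mSt : ∀ u e, e ∈ St u → ∃ i j, j ≠ n₀ ∧ e = s(u, g i j) := by
    intro u e he
    obtain ⟨j, hj, he⟩ := Multiset.mem_sum.1 he
    obtain ⟨i, rfl⟩ := mem_starEdges.1 he
    exact ⟨i, j, Finset.ne_of_mem_erase hj, rfl⟩
  have mRows : ∀ e, e ∈ Rows → ∃ i j j', H.Adj j j' ∧ e = s(g i j, g i j') := by
    intro e he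
    obtain ⟨i, -, he⟩ := Multiset.mem_sum.1 he
    obtain ⟨j, j', h, rfl⟩ := mem_copyEdges.1 he
    exact ⟨i, j, j', h, rfl⟩
  have mCols : ∀ e, e ∈ Cols → ∃ i i' j, j ≠ n₀ ∧ H.Adj i i' ∧ e = s(g i j, g i' j) := by
    intro e he
    obtain ⟨j, hj, he⟩ := Multiset.mem_sum.1 he
    obtain ⟨i, i', h, rfl⟩ := mem_copyEdges.1 he
    exact ⟨i, i', j, Finset.ne_of_mem_erase hj, h, rfl⟩
  have nSt : ∀ u, (St u).Nodup := by
    intro u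
    refine nodup_sum (fun j _ => starEdges_nodup (gcol j)) fun j _ j' _ e he he' => ?_
    obtain ⟨i, rfl⟩ := mem_starEdges.1 he
    obtain ⟨i', h⟩ := mem_starEdges.1 he'
    exact (ginj _ _ _ _ (Sym2.congr_right.1 h)).2
  have nRows : Rows.Nodup := by
    refine nodup_sum (fun j _ => copyEdges_nodup _ (grow j)) fun i _ i' _ e he he' => ?_
    obtain ⟨j, j', -, rfl⟩ := mem_copyEdges.1 he
    obtain ⟨k, k', -, h⟩ := mem_copyEdges.1 he'
    rcases Sym2.eq_iff.1 h with ⟨h, -⟩ | ⟨h, -⟩ <;> exact (ginj _ _ _ _ h).1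
  have nCols : Cols.Nodup := by
    refine nodup_sum (fun j _ => copyEdges_nodup _ (gcol j)) fun i _ i' _ e he he' => ?_
    obtain ⟨j, j', -, rfl⟩ := mem_copyEdges.1 he
    obtain ⟨k, k', -, h⟩ := mem_copyEdges.1 he'
    rcases Sym2.eq_iff.1 h with ⟨h, -⟩ | ⟨h, -⟩ <;> exact (ginj _ _ _ _ h).2
  refine ⟨N₀, St v + St p + (Rows + Cols), ?_, ?_, ⟨?_, ?_, ?_, ?_⟩, ?_⟩
  · rw [Finset.disjoint_left]
    intro u hu
    obtain ⟨q, -, rfl⟩ := Finset.mem_image.1 hu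
    exact hφB q
  · refine Finset.card_image_le.trans ?_
    rw [Finset.card_univ, Fintype.card_prod]
    change Fintype.card (F.neighborSet x) * _ ≤ _
    rw [hcard]
    exact Nat.mul_le_mul_left _ (by omega)
  · refine Multiset.nodup_add.2 ⟨Multiset.nodup_add.2 ⟨nSt v, nSt p, ?_⟩,
      Multiset.nodup_add.2 ⟨nRows, nCols, ?_⟩, ?_⟩
    · rw [Multiset.disjoint_left]
      intro e he he'
      obtain ⟨i, j, -, rfl⟩ := mSt _ _ he
      obtain ⟨i', j', -, h⟩ := mSt _ _ he'
      rcases Sym2.eq_iff.1 h with ⟨h, -⟩ | ⟨h, -⟩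
      exacts [hvp h, gv _ _ h.symm]
    · rw [Multiset.disjoint_left]
      intro e he he'
      obtain ⟨i, j, j', hj, rfl⟩ := mRows _ he
      obtain ⟨k, k', l, -, hk, h⟩ := mCols _ he'
      rcases Sym2.eq_iff.1 h with ⟨h, h'⟩ | ⟨h, h'⟩
      all_goals exact hj.ne ((ginj _ _ _ _ h).2.trans (ginj _ _ _ _ h').2.symm)
    · rw [Multiset.disjoint_left]
      intro e he he'
      have h1 : v ∈ e ∨ p ∈ e := by
        rcases Multiset.mem_add.1 he with he | he
        all_goals obtain ⟨i, j, -, rfl⟩ := mSt _ _ he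
        exacts [Or.inl (by simp), Or.inr (by simp)]
      have h2 : ∀ w ∈ e, ∃ i j, w = g i j := by
        intro w hw
        rcases Multiset.mem_add.1 he' with he | he
        · obtain ⟨i, j, j', -, rfl⟩ := mRows _ he
          rcases Sym2.mem_iff.1 hw with rfl | rfl <;> exact ⟨_, _, rfl⟩
        · obtain ⟨i, i', j, -, -, rfl⟩ := mCols _ he
          rcases Sym2.mem_iff.1 hw with rfl | rfl <;> exact ⟨_, _, rfl⟩
      rcases h1 with h1 | h1
      all_goals obtain ⟨i, j, h⟩ := h2 _ h1
      exacts [gv _ _ h.symm, gp _ _ h.symm]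
  · intro e he
    rcases Multiset.mem_add.1 he with he | he <;> rcases Multiset.mem_add.1 he with he | he
    · obtain ⟨i, j, hj, rfl⟩ := mSt _ _ he
      exact adjv i j hj
    · obtain ⟨i, j, hj, rfl⟩ := mSt _ _ he
      exact adjp i j hj
    · obtain ⟨i, j, j', h, rfl⟩ := mRows _ he
      exact adjrow i j j' h
    · obtain ⟨i, i', j, hj, h, rfl⟩ := mCols _ he
      exact adjcol i i' j hj h
  · intro e he
    rcases Multiset.mem_add.1 he with he | he <;> rcases Multiset.mem_add.1 he with he | he
    · obtain ⟨i, j, hj, rfl⟩ := mSt _ _ he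
      exact ⟨_, Sym2.mem_mk_right _ _, gN i j hj⟩
    · obtain ⟨i, j, hj, rfl⟩ := mSt _ _ he
      exact ⟨_, Sym2.mem_mk_right _ _, gN i j hj⟩
    · obtain ⟨i, j, j', h, rfl⟩ := mRows _ he
      by_cases hj : j = n₀
      · exact ⟨_, Sym2.mem_mk_right _ _, gN i j' fun hj' => h.ne (hj.trans hj'.symm)⟩
      · exact ⟨_, Sym2.mem_mk_left _ _, gN i j hj⟩
    · obtain ⟨i, i', j, hj, h, rfl⟩ := mCols _ he
      exact ⟨_, Sym2.mem_mk_left _ _, gN i j hj⟩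
  · intro e he w hw
    rcases Multiset.mem_add.1 he with he | he <;> rcases Multiset.mem_add.1 he with he | he
    · obtain ⟨i, j, hj, rfl⟩ := mSt _ _ he
      rcases Sym2.mem_iff.1 hw with rfl | rfl
      exacts [Or.inl hv, gRN i j]
    · obtain ⟨i, j, hj, rfl⟩ := mSt _ _ he
      rcases Sym2.mem_iff.1 hw with rfl | rfl
      exacts [Or.inl hp, gRN i j]
    · obtain ⟨i, j, j', h, rfl⟩ := mRows _ he
      rcases Sym2.mem_iff.1 hw with rfl | rfl <;> exact gRN _ _
    · obtain ⟨i, i', j, hj, h, rfl⟩ := mCols _ he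
      rcases Sym2.mem_iff.1 hw with rfl | rfl <;> exact gRN _ _
  · have gR : ∀ i j, g i j ∈ R ∪ N₀ := fun i j => Finset.mem_union.2 (gRN i j)
    have hvR : v ∈ R ∪ N₀ := Finset.mem_union_left _ hv
    have hpR : p ∈ R ∪ N₀ := Finset.mem_union_left _ hp
    have c1 := Convertible.sum Finset.univ (P := fun i => coneEdges F x v (g i))
      (Q := fun i => coneEdges F x p (g i)) fun i _ =>
        convertible_cone hF hG x (grow i) hvR hpR (gR i) (gv i) (gp i)
    have c2 := Convertible.sum s (P := fun j => coneEdges F x p fun i => g i j)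
      (Q := fun j => coneEdges F x v fun i => g i j) fun j _ =>
        convertible_cone hF hG x (gcol j) hpR hvR (fun i => gR i j) (fun i => gp i j)
          (fun i => gv i j)
    have hrow : ∀ u, ∑ i, starEdges u (g i) = starEdges u z + St u := by
      intro u
      simp only [starEdges, St]
      rw [Finset.sum_comm, ← Finset.add_sum_erase _ _ (Finset.mem_univ n₀)]
      simp only [g0]
      rfl
    have e1 : ∀ u, ∑ i, coneEdges F x u (g i) = starEdges u z + St u + Rows := fun u => by
      rw [← hrow, ← Finset.sum_add_distrib]; rfl
    have e2 : ∀ u, ∑ j ∈ s, coneEdges F x u (fun i => g i j) = St u + Cols := fun u => by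
      rw [← Finset.sum_add_distrib]; rfl
    have c := c1.add c2
    rw [e1, e1, e2, e2] at c
    have hsc : s.card ≤ r := by
      refine Finset.card_le_univ _ |>.trans ?_
      exact hcard.le
    have hc' : (Finset.univ : Finset N).card = r := hcard
    have h := c.mono (k₂ := 2 * r * Fintype.card W) subset_rfl (by
      rw [hc', two_mul, add_mul]
      exact Nat.add_le_add_left (Nat.mul_le_mul_right _ hsc) _)
    convert h using 1 <;> abel

/-- The edges `vu` and `xy` can be replaced by `xu` and `vy`. -/
theorem convertible_switch (hF : F.IsRegularOfDegree r) (hG : HasCommonNeighbors G (3 * r) b)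
    {w : W} (n₀ : F.neighborSet w) {v u x y : V} (hv : v ∈ R) (hu : u ∈ R) (hx : x ∈ R)
    (hy : y ∈ R) (hvu : v ≠ u) (hvx : v ≠ x) (hvy : v ≠ y) (hux : u ≠ x)
    (hxy : x ≠ y) :
    Convertible F G b R (r + 2 * (r * r + 2 * r * Fintype.card W))
      ({s(v, u)} + {s(x, y)}) ({s(x, u)} + {s(v, y)}) := by
  -- With `r - 1` common new leaves, the star at `v` over `u` and these leaves moves to `x`, while
  -- the star at `x` over `y` and the same leaves moves to `v`. The edges to the new leaves just
  -- trade places, so they are a catalyst.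
  refine Convertible.of_fresh fun B hB hk => ?_
  have hcard := card_neighborSet hF w
  let N := F.neighborSet w
  let M := {j : N // j ≠ n₀}
  have hM : Fintype.card M + 1 = r := by
    rw [← Nat.card_eq_fintype_card]
    exact card_neighborSet_ne hF n₀
  obtain ⟨φ, hφ, hφB, hφatt, -⟩ := hG.exists_embedding (X := M) (fun _ => {v, x}) ⊥
    (by
      intro q
      refine (add_le_add Finset.card_le_two (?_ : _ ≤ 0)).trans (by omega)
      simp) B (by omega)
  let ν : V → N → V := fun a j => if h : j = n₀ then a else φ ⟨j, h⟩
  have ν0 : ∀ a, ν a n₀ = a := fun a => by simp [ν]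
  have ν1 : ∀ a j (h : j ≠ n₀), ν a j = φ ⟨j, h⟩ := fun a j h => by simp [ν, h]
  have hφR : ∀ q, φ q ∉ R := fun q h => hφB q (hB h)
  have νinj : ∀ a ∈ R, Function.Injective (ν a) := by
    intro a ha i j h
    by_cases hi : i = n₀ <;> by_cases hj : j = n₀
    · rw [hi, hj]
    · rw [hi, ν0, ν1 _ _ hj] at h
      exact (hφR _ (h ▸ ha)).elim
    · rw [hj, ν0, ν1 _ _ hi] at h
      exact (hφR _ (h ▸ ha)).elim
    · rw [ν1 _ _ hi, ν1 _ _ hj] at h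
      exact congrArg Subtype.val (hφ h)
  have νne : ∀ a c, c ∈ R → a ≠ c → ∀ j, ν a j ≠ c := by
    intro a c hc hac j
    by_cases hj : j = n₀
    · rwa [hj, ν0]
    · rw [ν1 _ _ hj]
      exact fun h => hφR _ (h ▸ hc)
  let N₀ : Finset V := Finset.univ.image φ
  have νR : ∀ a ∈ R, ∀ j, ν a j ∈ R ∪ N₀ := by
    intro a ha j
    by_cases hj : j = n₀
    · rw [hj, ν0]; exact Finset.mem_union_left _ ha
    · rw [ν1 _ _ hj]
      exact Finset.mem_union_right _ (Finset.mem_image_of_mem _ (Finset.mem_univ _))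
  refine ⟨N₀, starEdges v φ + starEdges x φ, ?_, ?_, ⟨?_, ?_, ?_, ?_⟩, ?_⟩
  · rw [Finset.disjoint_left]
    intro u hu
    obtain ⟨q, -, rfl⟩ := Finset.mem_image.1 hu
    exact hφB q
  · refine Finset.card_image_le.trans ?_
    rw [Finset.card_univ]
    omega
  · refine Multiset.nodup_add.2 ⟨starEdges_nodup hφ, starEdges_nodup hφ, ?_⟩
    rw [Multiset.disjoint_left]
    intro e he he'
    obtain ⟨i, rfl⟩ := mem_starEdges.1 he
    obtain ⟨j, h⟩ := mem_starEdges.1 he'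
    rcases Sym2.eq_iff.1 h with ⟨h, -⟩ | ⟨h, -⟩
    exacts [hvx h, hφR _ (h ▸ hv)]
  · intro e he
    rcases Multiset.mem_add.1 he with he | he <;> obtain ⟨i, rfl⟩ := mem_starEdges.1 he <;>
      exact hφatt _ _ (by simp)
  · intro e he
    rcases Multiset.mem_add.1 he with he | he <;> obtain ⟨i, rfl⟩ := mem_starEdges.1 he <;>
      exact ⟨_, Sym2.mem_mk_right _ _, Finset.mem_image_of_mem _ (Finset.mem_univ _)⟩
  · intro e he a ha
    rcases Multiset.mem_add.1 he with he | he <;> obtain ⟨i, rfl⟩ := mem_starEdges.1 he <;>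
      rcases Sym2.mem_iff.1 ha with rfl | rfl
    exacts [Or.inl hv, Or.inr (Finset.mem_image_of_mem _ (Finset.mem_univ _)), Or.inl hx,
      Or.inr (Finset.mem_image_of_mem _ (Finset.mem_univ _))]
  · have hvR : v ∈ R ∪ N₀ := Finset.mem_union_left _ hv
    have hxR : x ∈ R ∪ N₀ := Finset.mem_union_left _ hx
    have c1 := convertible_star hF hG n₀ (νinj u hu) hvR hxR (νR u hu) (νne u v hv hvu.symm)
      (νne u x hx hux) hvx
    have c2 := convertible_star hF hG n₀ (νinj y hy) hxR hvR (νR y hy) (νne y x hx hxy.symm)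
      (νne y v hv hvy.symm) hvx.symm
    have hst : ∀ c a, starEdges c (ν a) = {s(c, a)} + starEdges c φ := by
      intro c a
      rw [starEdges, ← Finset.add_sum_erase _ _ (Finset.mem_univ n₀), ν0, starEdges]
      congr 1
      rw [Finset.sum_subtype (Finset.univ.erase n₀) (p := fun j => j ≠ n₀) (by simp)
        (fun j => ({s(c, ν a j)} : Multiset (Sym2 V)))]
      refine Finset.sum_congr rfl fun j _ => ?_
      rw [ν1 _ _ j.2]
    have c := c1.add c2
    rw [hst, hst, hst, hst, ← two_mul] at c
    convert c using 1 <;> abel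

end Swap

/-! ### From switches to absorbers -/

section Absorber

variable {W V : Type*} [Fintype W] {F : SimpleGraph W} {G : SimpleGraph V} {b r : ℕ} {R : Finset V}

theorem countP_sum {α ι : Type*} (q : α → Prop) [DecidablePred q] (s : Finset ι)
    (f : ι → Multiset α) : (∑ i ∈ s, f i).countP q = ∑ i ∈ s, (f i).countP q :=
  map_sum (Multiset.countPAddMonoidHom q) f s

theorem countP_singleton {α : Type*} (q : α → Prop) [DecidablePred q] (a : α) :
    ({a} : Multiset α).countP q = if q a then 1 else 0 := by
  rw [← Multiset.cons_zero, Multiset.countP_cons, Multiset.countP_zero, zero_add]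

theorem countP_mem_edgeFinset (F : SimpleGraph W) (w : W) :
    F.edgeFinset.val.countP (fun e => w ∈ e) = F.degree w := by
  rw [Multiset.countP_eq_card_filter, ← Finset.filter_val, Finset.card_val,
    ← SimpleGraph.card_incidenceFinset_eq_degree, SimpleGraph.incidenceFinset_eq_filter]

theorem card_copyEdges (F : SimpleGraph W) (φ : W → V) :
    Multiset.card (copyEdges F φ) = F.edgeFinset.card := by
  simp [copyEdges]

theorem dvd_countP_copyEdges (hF : ∀ w, r ∣ F.degree w) {φ : W → V}
    (hφ : Function.Injective φ) (v : V) : r ∣ (copyEdges F φ).countP (fun e => v ∈ e) := by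
  rw [copyEdges, Multiset.countP_map, ← Multiset.countP_eq_card_filter]
  by_cases hv : ∃ w, φ w = v
  · obtain ⟨w, rfl⟩ := hv
    have : ∀ e : Sym2 W, φ w ∈ Sym2.map φ e ↔ w ∈ e := by
      intro e
      rw [Sym2.mem_map]
      exact ⟨fun ⟨a, ha, h⟩ => hφ h ▸ ha, fun h => ⟨w, h, rfl⟩⟩
    simp only [this]
    rw [countP_mem_edgeFinset]
    exact hF w
  · rw [Multiset.countP_eq_zero.2]
    · exact dvd_zero _
    · intro e _ he
      obtain ⟨a, -, h⟩ := Sym2.mem_map.1 he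
      exact hv ⟨a, h⟩

theorem dvd_countP_of_decomposable (hF : F.IsRegularOfDegree r) {T : Multiset (Sym2 V)}
    (hT : T ∈ decomposable F V) (v : V) : r ∣ T.countP (fun e => v ∈ e) := by
  induction hT using AddSubmonoid.closure_induction with
  | mem x hx =>
    obtain ⟨φ, hφ, rfl⟩ := hx
    exact dvd_countP_copyEdges (fun w => by rw [hF.degree_eq]) hφ v
  | zero => simp
  | add x y _ _ hx hy => rw [Multiset.countP_add]; exact dvd_add hx hy

theorem dvd_card_of_decomposable {T : Multiset (Sym2 V)} (hT : T ∈ decomposable F V) :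
    F.edgeFinset.card ∣ Multiset.card T := by
  induction hT using AddSubmonoid.closure_induction with
  | mem x hx =>
    obtain ⟨φ, hφ, rfl⟩ := hx
    rw [card_copyEdges]
  | zero => simp
  | add x y _ _ hx hy => rw [Multiset.card_add]; exact dvd_add hx hy

/-- The number of new vertices needed to change the centre of a star. -/
def starCost (r f : ℕ) : ℕ := r * r + 2 * r * f

/-- The number of new vertices needed to switch two edges. -/
def switchCost (r f : ℕ) : ℕ := r + 2 * starCost r f

/-- If each vertex is the end of a multiple of `r` edges, then all ends can be moved to `p`. -/
theorem convertible_gather (hF : F.IsRegularOfDegree r) (hr : 0 < r)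
    (hG : HasCommonNeighbors G (3 * r) b) {x : W} (n₀ : F.neighborSet x) {κ : Type*}
    {tip port : κ → V} {p : V} (hport : Function.Injective port) (hp : p ∈ R)
    (htR : ∀ i, tip i ∈ R) (hpR : ∀ i, port i ∈ R) (hpt : ∀ i j, port i ≠ tip j)
    (hpp : ∀ i, port i ≠ p) (htp : ∀ i, tip i ≠ p) (I : Finset κ)
    (hdiv : ∀ v, r ∣ (I.filter fun i => tip i = v).card) :
    Convertible F G b R (I.card * starCost r (Fintype.card W)) (∑ i ∈ I, {s(tip i, port i)})
      (∑ i ∈ I, {s(p, port i)}) := by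
  induction I using Finset.strongInduction with
  | H I ih =>
    rcases I.eq_empty_or_nonempty with rfl | ⟨i, hi⟩
    · simpa using Convertible.zero
    -- By divisibility a tip that occurs at all occurs at least `r` times. Exactly `r` of its edges
    -- form a star that can be re-centred at `p`, and removing them preserves divisibility.
    have hle : r ≤ (I.filter fun j => tip j = tip i).card :=
      Nat.le_of_dvd (Finset.card_pos.2 ⟨i, Finset.mem_filter.2 ⟨hi, rfl⟩⟩) (hdiv _)
    obtain ⟨t, ht, htc⟩ := Finset.exists_subset_card_eq hle
    have htI : t ⊆ I := ht.trans (Finset.filter_subset _ _)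
    have htt : ∀ j ∈ t, tip j = tip i := fun j hj => (Finset.mem_filter.1 (ht hj)).2
    have hne : t.Nonempty := Finset.card_pos.1 (htc ▸ hr)
    let e : F.neighborSet x ≃ t := Fintype.equivOfCardEq (by
      rw [card_neighborSet hF, Fintype.card_coe, htc])
    have hstar : ∀ u, starEdges u (fun n => port (e n)) = ∑ j ∈ t, {s(u, port j)} := by
      intro u
      rw [starEdges, e.sum_comp fun j : t => ({s(u, port j)} : Multiset (Sym2 V)),
        Finset.sum_coe_sort t fun j => ({s(u, port j)} : Multiset (Sym2 V))]
    have c1 := convertible_star hF hG n₀ (v := tip i) (p := p) (z := fun n => port (e n))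
      (fun a c h => e.injective (Subtype.ext (hport h))) (htR i) hp (fun n => hpR _)
      (fun n => hpt _ _) (fun n => hpp _) (htp i)
    rw [hstar, hstar] at c1
    have c2 := ih (I \ t) (Finset.sdiff_ssubset htI hne) (by
      intro v
      by_cases hv : v = tip i
      · have : ((I \ t).filter fun j => tip j = v) = (I.filter fun j => tip j = tip i) \ t := by
          ext j; simp [hv]; tauto
        rw [this, Finset.card_sdiff_of_subset ht, htc]
        exact Nat.dvd_sub (hdiv _) dvd_rfl
      · have : ((I \ t).filter fun j => tip j = v) = I.filter fun j => tip j = v := by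
          ext j
          simp only [Finset.mem_filter, Finset.mem_sdiff]
          refine ⟨fun h => ⟨h.1.1, h.2⟩, fun h => ⟨⟨h.1, fun hj => hv ?_⟩, h.2⟩⟩
          rw [← h.2, htt j hj]
        rw [this]
        exact hdiv v)
    have c := c1.add c2
    have h1 : ∑ j ∈ t, ({s(tip i, port j)} : Multiset (Sym2 V)) =
        ∑ j ∈ t, {s(tip j, port j)} := Finset.sum_congr rfl fun j hj => by rw [htt j hj]
    rw [h1, add_comm (∑ j ∈ t, _), add_comm (∑ j ∈ t, _), Finset.sum_sdiff htI,
      Finset.sum_sdiff htI] at c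
    refine c.mono subset_rfl ?_
    change starCost r (Fintype.card W) + _ ≤ _
    have h2 : (I \ t).card + 1 ≤ I.card := by
      rw [Finset.card_sdiff_of_subset htI]
      have := Finset.card_le_card htI
      omega
    calc _ = ((I \ t).card + 1) * starCost r (Fintype.card W) := by ring
      _ ≤ _ := Nat.mul_le_mul_right _ h2

/-- The number of new vertices needed to move the ends of `h` edges. -/
def portsCost (r f h : ℕ) : ℕ := h * switchCost r f + (h + h) * starCost r f

/-- The edges `a j, c j`, given as a family satisfying the degree condition, together with the
edges `xs j, ys j`, can be replaced by edges from `p` to the vertices `xs j` and `ys j`. -/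
theorem convertible_ports (hF : F.IsRegularOfDegree r) (hr : 0 < r)
    (hG : HasCommonNeighbors G (3 * r) b) {x : W} (n₀ : F.neighborSet x) {J : Type*} [Fintype J]
    {a c xs ys : J → V} {p : V} (hxs : Function.Injective xs) (hys : Function.Injective ys)
    (hxy : ∀ i j, xs i ≠ ys j) (hac : ∀ j, a j ≠ c j) (hp : p ∈ R) (haR : ∀ j, a j ∈ R)
    (hcR : ∀ j, c j ∈ R) (hxR : ∀ j, xs j ∈ R) (hyR : ∀ j, ys j ∈ R)
    (hxa : ∀ i j, xs i ≠ a j) (hxc : ∀ i j, xs i ≠ c j) (hya : ∀ i j, ys i ≠ a j)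
    (hyc : ∀ i j, ys i ≠ c j) (hxp : ∀ i, xs i ≠ p) (hyp : ∀ i, ys i ≠ p) (hap : ∀ i, a i ≠ p)
    (hcp : ∀ i, c i ≠ p)
    (hdiv : ∀ v, r ∣ (∑ j, ({s(a j, c j)} : Multiset (Sym2 V))).countP fun e => v ∈ e) :
    Convertible F G b R (portsCost r (Fintype.card W) (Fintype.card J))
      ((∑ j, {s(a j, c j)}) + (∑ j, {s(xs j, ys j)}) + ∑ j, ({s(a j, xs j)} + {s(c j, ys j)}))
      ((∑ j, ({s(a j, xs j)} + {s(c j, ys j)})) + ∑ j, ({s(p, xs j)} + {s(p, ys j)})) := by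
  -- The switches produce the edges `a j, xs j` and `c j, ys j`, and a second copy of these edges,
  -- present as a catalyst, is gathered at `p`. A vertex is a tip as often as it is an end of an
  -- edge `a j, c j`, so `hdiv` is the condition that `convertible_gather` needs.
  have c1 := Convertible.sum (k := switchCost r (Fintype.card W)) (Finset.univ : Finset J)
    (P := fun j => {s(a j, c j)} + {s(xs j, ys j)})
    (Q := fun j => {s(a j, xs j)} + {s(c j, ys j)}) fun j _ => by
      have := convertible_switch hF hG n₀ (hcR j) (haR j) (hxR j) (hyR j) (hac j).symm
        (hxc j j).symm (hyc j j).symm (hxa j j).symm (hxy j j)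
      rwa [show s(c j, a j) = s(a j, c j) from Sym2.eq_swap,
        show s(xs j, a j) = s(a j, xs j) from Sym2.eq_swap] at this
  have c2 := convertible_gather hF hr hG n₀ (κ := J ⊕ J) (tip := Sum.elim a c)
    (port := Sum.elim xs ys) (hxs.sumElim hys hxy) hp (by rintro (j | j) <;> simp [haR, hcR])
    (by rintro (j | j) <;> simp [hxR, hyR])
    (by rintro (j | j) (k | k) <;> simp [hxa, hxc, hya, hyc])
    (by rintro (j | j) <;> simp [hxp, hyp]) (by rintro (j | j) <;> simp [hap, hcp])
    Finset.univ (by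
      intro v
      have := hdiv v
      rw [countP_sum] at this
      convert this using 1
      rw [Finset.card_filter, Fintype.sum_sum_type, ← Finset.sum_add_distrib]
      refine Finset.sum_congr rfl fun j _ => ?_
      rw [countP_singleton]
      have := hac j
      by_cases h1 : a j = v <;> by_cases h2 : c j = v
      · exact (this (h1.trans h2.symm)).elim
      all_goals simp [h1, h2, Sym2.mem_iff, eq_comm (a := v)])
  rw [Finset.card_univ, Fintype.card_sum] at c2
  rw [Fintype.sum_sum_type, Fintype.sum_sum_type, ← Finset.sum_add_distrib,
    ← Finset.sum_add_distrib] at c2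
  simp only [Sum.elim_inl, Sum.elim_inr] at c2
  have h := c1.add c2
  rwa [Finset.sum_add_distrib (f := fun j => ({s(a j, c j)} : Multiset (Sym2 V))),
    Finset.card_univ] at h

/-- Attaching independent new vertices to prescribed sets of roots. -/
theorem exists_attached (hG : HasCommonNeighbors G (3 * r) b) {X : Type*} [Fintype X]
    (att : X → Finset V) (hatt : ∀ x, (att x).card ≤ 3 * r) (hR : ∀ x, att x ⊆ R) {B : Finset V}
    (hRB : R ⊆ B) (hB : B.card + Fintype.card X ≤ b) :
    ∃ φ : X → V, Function.Injective φ ∧ (∀ x, φ x ∉ B) ∧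
      Fresh G R (Finset.univ.image φ) (∑ x, ∑ v ∈ att x, {s(v, φ x)}) := by
  obtain ⟨φ, hφ, hφB, hφatt, -⟩ := hG.exists_embedding att ⊥
    (fun x => le_trans (add_le_add (hatt x) (by simp : _ ≤ 0)) le_rfl) B hB
  · have hmem : ∀ e ∈ ∑ x, ∑ v ∈ att x, ({s(v, φ x)} : Multiset (Sym2 V)),
        ∃ x, ∃ v ∈ att x, e = s(v, φ x) := by
      intro e he
      obtain ⟨x, -, he⟩ := Multiset.mem_sum.1 he
      obtain ⟨v, hv, he⟩ := Multiset.mem_sum.1 he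
      exact ⟨x, v, hv, Multiset.mem_singleton.1 he⟩
    refine ⟨φ, hφ, hφB, ?_, ?_, ?_, ?_⟩
    · refine nodup_sum (fun x _ => nodup_sum (fun _ _ => Multiset.nodup_singleton _) ?_) ?_
      · intro v _ v' _ e he he'
        rw [Multiset.mem_singleton] at he he'
        exact Sym2.congr_left.1 (he.symm.trans he')
      · intro x _ x' _ e he he'
        obtain ⟨v, hv, he⟩ := Multiset.mem_sum.1 he
        obtain ⟨v', hv', he'⟩ := Multiset.mem_sum.1 he'
        rw [Multiset.mem_singleton] at he he'
        rcases Sym2.eq_iff.1 (he.symm.trans he') with ⟨-, h⟩ | ⟨h, -⟩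
        · exact hφ h
        · exact (hφB _ (hRB (hR _ (h ▸ hv)))).elim
    · intro e he
      obtain ⟨x, v, hv, rfl⟩ := hmem e he
      exact hφatt x v hv
    · intro e he
      obtain ⟨x, v, hv, rfl⟩ := hmem e he
      exact ⟨_, Sym2.mem_mk_right _ _, Finset.mem_image_of_mem _ (Finset.mem_univ _)⟩
    · intro e he w hw
      obtain ⟨x, v, hv, rfl⟩ := hmem e he
      rcases Sym2.mem_iff.1 hw with rfl | rfl
      exacts [Or.inl (hR _ hv), Or.inr (Finset.mem_image_of_mem _ (Finset.mem_univ _))]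

/-- Edges from `p` to pairs of vertices indexed by the edges of `F` can be replaced by the edges
joining these pairs. -/
theorem convertible_contract (hF : F.IsRegularOfDegree r) (hr : 0 < r)
    (hG : HasCommonNeighbors G (3 * r) b) {x : W} (n₀ : F.neighborSet x)
    {xs ys : F.edgeSet → V} {p : V} (hxs : Function.Injective xs) (hys : Function.Injective ys)
    (hxy : ∀ i j, xs i ≠ ys j) (hp : p ∈ R) (hxR : ∀ j, xs j ∈ R) (hyR : ∀ j, ys j ∈ R)
    (hxp : ∀ i, xs i ≠ p) (hyp : ∀ i, ys i ≠ p) :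
    Convertible F G b R
      (Fintype.card W + portsCost r (Fintype.card W) (Fintype.card F.edgeSet))
      (∑ j, ({s(p, xs j)} + {s(p, ys j)})) (∑ j, {s(xs j, ys j)}) := by
  refine Convertible.of_fresh fun B hB hk => ?_
  have hends : ∀ e : F.edgeSet, ∃ q : W × W, e.1 = s(q.1, q.2) := fun e => by
    induction h : e.1 with
    | _ u v => exact ⟨(u, v), rfl⟩
  choose q hq using hends
  have hadj : ∀ e, F.Adj (q e).1 (q e).2 := fun e => by
    have := e.2
    rwa [hq] at this
  let att : W → Finset V := fun w =>
    ((Finset.univ.filter fun e => (q e).1 = w).image xs) ∪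
      ((Finset.univ.filter fun e => (q e).2 = w).image ys)
  have hatt : ∀ w, (att w).card ≤ r := by
    intro w
    refine (Finset.card_union_le _ _).trans ((add_le_add Finset.card_image_le
      Finset.card_image_le).trans ?_)
    rw [← Finset.card_union_of_disjoint, ← hF.degree_eq w,
      ← SimpleGraph.card_incidenceFinset_eq_degree]
    · refine Finset.card_le_card_of_injOn (fun e => e.1) (fun e he => ?_)
        Subtype.val_injective.injOn
      simp only [Finset.coe_union, Finset.coe_filter, Finset.mem_univ, true_and, Set.mem_union,
        Set.mem_ofPred_eq] at he
      simp only [SimpleGraph.coe_incidenceFinset, SimpleGraph.incidenceSet, Set.mem_ofPred_eq]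
      refine ⟨e.2, ?_⟩
      rw [hq e, Sym2.mem_iff]
      exact he.imp Eq.symm Eq.symm
    · rw [Finset.disjoint_left]
      intro e he he'
      exact (hadj e).ne ((Finset.mem_filter.1 he).2.trans (Finset.mem_filter.1 he').2.symm)
  obtain ⟨φ, hφ, hφB, hφatt, hφrel⟩ := hG.exists_embedding att F (fun w => by
    rw [hF.degree_eq]
    have := hatt w
    omega) B (by omega)
  have hφR : ∀ w, φ w ∉ R := fun w h => hφB w (hB h)
  have hφne : ∀ v ∈ R, ∀ w, φ w ≠ v := fun v hv w h => hφR w (h ▸ hv)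
  let N₀ : Finset V := Finset.univ.image φ
  have hN : ∀ w, φ w ∈ N₀ := fun w => Finset.mem_image_of_mem _ (Finset.mem_univ _)
  let a : F.edgeSet → V := fun e => φ (q e).1
  let c : F.edgeSet → V := fun e => φ (q e).2
  have hY : copyEdges F φ = ∑ e, {s(a e, c e)} := by
    have h1 : copyEdges F φ = ∑ e ∈ F.edgeFinset, {Sym2.map φ e} := by
      rw [copyEdges, ← Multiset.sum_map_singleton (F.edgeFinset.val.map _), Multiset.map_map]
      rfl
    rw [h1, Finset.sum_subtype F.edgeFinset (p := fun e => e ∈ F.edgeSet) (by simp)]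
    refine Finset.sum_congr rfl fun e _ => ?_
    rw [hq e]
    rfl
  let U : Multiset (Sym2 V) := ∑ e, ({s(a e, xs e)} + {s(c e, ys e)})
  have hU : U = (∑ e, {s(a e, xs e)}) + ∑ e, {s(c e, ys e)} := Finset.sum_add_distrib
  have mU : ∀ e ∈ U, ∃ w, ∃ v ∈ att w, e = s(φ w, v) := by
    intro e he
    obtain ⟨i, -, he⟩ := Multiset.mem_sum.1 he
    rcases Multiset.mem_add.1 he with he | he <;> rw [Multiset.mem_singleton] at he
    · exact ⟨(q i).1, xs i, Finset.mem_union_left _ (Finset.mem_image_of_mem _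
        (Finset.mem_filter.2 ⟨Finset.mem_univ _, rfl⟩)), he⟩
    · exact ⟨(q i).2, ys i, Finset.mem_union_right _ (Finset.mem_image_of_mem _
        (Finset.mem_filter.2 ⟨Finset.mem_univ _, rfl⟩)), he⟩
  have hattR : ∀ w, ∀ v ∈ att w, v ∈ R := by
    intro w v hv
    rcases Finset.mem_union.1 hv with hv | hv <;> obtain ⟨i, -, rfl⟩ := Finset.mem_image.1 hv
    exacts [hxR i, hyR i]
  have hnU : U.Nodup := by
    rw [hU]
    refine Multiset.nodup_add.2 ⟨?_, ?_, ?_⟩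
    · refine nodup_sum (fun _ _ => Multiset.nodup_singleton _) fun i _ j _ e he he' => ?_
      rw [Multiset.mem_singleton] at he he'
      rcases Sym2.eq_iff.1 (he.symm.trans he') with ⟨-, h⟩ | ⟨h, -⟩
      exacts [hxs h, (hφne _ (hxR j) _ h).elim]
    · refine nodup_sum (fun _ _ => Multiset.nodup_singleton _) fun i _ j _ e he he' => ?_
      rw [Multiset.mem_singleton] at he he'
      rcases Sym2.eq_iff.1 (he.symm.trans he') with ⟨-, h⟩ | ⟨h, -⟩
      exacts [hys h, (hφne _ (hyR j) _ h).elim]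
    · rw [Multiset.disjoint_left]
      intro e he he'
      obtain ⟨i, -, he⟩ := Multiset.mem_sum.1 he
      obtain ⟨j, -, he'⟩ := Multiset.mem_sum.1 he'
      rw [Multiset.mem_singleton] at he he'
      rcases Sym2.eq_iff.1 (he.symm.trans he') with ⟨-, h⟩ | ⟨h, -⟩
      exacts [hxy _ _ h, (hφne _ (hyR j) _ h).elim]
  refine ⟨N₀, U + copyEdges F φ, ?_, ?_, ⟨?_, ?_, ?_, ?_⟩, ?_⟩
  · rw [Finset.disjoint_left]
    intro u hu
    obtain ⟨w, -, rfl⟩ := Finset.mem_image.1 hu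
    exact hφB w
  · exact Finset.card_image_le
  · refine Multiset.nodup_add.2 ⟨hnU, copyEdges_nodup _ hφ, ?_⟩
    rw [Multiset.disjoint_left]
    intro e he he'
    obtain ⟨w, v, hv, rfl⟩ := mU e he
    obtain ⟨u, u', -, h⟩ := mem_copyEdges.1 he'
    rcases Sym2.eq_iff.1 h with ⟨-, h⟩ | ⟨-, h⟩
    all_goals exact hφR _ (h ▸ hattR _ _ hv)
  · intro e he
    rcases Multiset.mem_add.1 he with he | he
    · obtain ⟨w, v, hv, rfl⟩ := mU e he
      exact (hφatt w v hv).symm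
    · obtain ⟨u, u', h, rfl⟩ := mem_copyEdges.1 he
      exact hφrel _ _ h
  · intro e he
    rcases Multiset.mem_add.1 he with he | he
    · obtain ⟨w, v, hv, rfl⟩ := mU e he
      exact ⟨_, Sym2.mem_mk_left _ _, hN w⟩
    · obtain ⟨u, u', h, rfl⟩ := mem_copyEdges.1 he
      exact ⟨_, Sym2.mem_mk_left _ _, hN u⟩
  · intro e he z hz
    rcases Multiset.mem_add.1 he with he | he
    · obtain ⟨w, v, hv, rfl⟩ := mU e he
      rcases Sym2.mem_iff.1 hz with rfl | rfl
      exacts [Or.inr (hN w), Or.inl (hattR _ _ hv)]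
    · obtain ⟨u, u', h, rfl⟩ := mem_copyEdges.1 he
      rcases Sym2.mem_iff.1 hz with rfl | rfl
      exacts [Or.inr (hN u), Or.inr (hN u')]
  · have hl : ∀ v ∈ R, v ∈ R ∪ N₀ := fun v hv => Finset.mem_union_left _ hv
    have hne : ∀ v ∈ R, ∀ w, v ≠ φ w := fun v hv w h => hφR w (h ▸ hv)
    -- A new copy of `F` takes the part of the edges `a j, c j`. Read backwards, the exchange turns
    -- spokes at `p` into this copy together with the edges `xs j, ys j`. Since the copy is itself
    -- decomposable, it may be added on the other side too, and then it is a catalyst.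
    have c1 := convertible_ports (R := R ∪ N₀) hF hr hG n₀ (a := a) (c := c) hxs hys hxy
      (fun e h => (hadj e).ne (hφ h)) (hl _ hp) (fun e => Finset.mem_union_right _ (hN _))
      (fun e => Finset.mem_union_right _ (hN _)) (fun j => hl _ (hxR j)) (fun j => hl _ (hyR j))
      (fun i j => hne _ (hxR i) _) (fun i j => hne _ (hxR i) _) (fun i j => hne _ (hyR i) _)
      (fun i j => hne _ (hyR i) _) hxp hyp (fun i => (hne _ hp _).symm)
      (fun i => (hne _ hp _).symm) (fun v => by
        rw [← hY]; exact dvd_countP_copyEdges (fun w => by rw [hF.degree_eq]) hφ v)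
    have c2 := c1.symm.add_decomposable_left (copyEdges_mem_decomposable F hφ)
    rw [← hY] at c2
    convert c2 using 1
    · simp only [U]; abel
    · simp only [U]; abel

theorem exists_sum_eq {X : Multiset (Sym2 V)} {J : Type*} [Fintype J]
    (h : Fintype.card J = Multiset.card X) :
    ∃ a c : J → V, X = ∑ j, {s(a j, c j)} := by
  let e : J ≃ X.ToType := Fintype.equivOfCardEq (by rw [h, Multiset.card_coe])
  have hends : ∀ d : Sym2 V, ∃ q : V × V, d = s(q.1, q.2) := fun d => by
    induction d with
    | _ u v => exact ⟨(u, v), rfl⟩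
  choose q hq using hends
  refine ⟨fun j => (q (e j).1).1, fun j => (q (e j).1).2, ?_⟩
  simp only [← hq]
  rw [e.sum_comp fun d : X.ToType => ({d.1} : Multiset (Sym2 V))]
  conv_lhs => rw [← Multiset.map_univ_coe X]
  simp [Finset.sum]

/-- The number of new vertices in an absorber for `k * e(F)` edges. -/
def absorberCost (r f D k : ℕ) : ℕ :=
  1 + (k * D + (k * D + (portsCost r f (k * D) + k * (f + portsCost r f D))))

/-- Existence of absorbers. -/
theorem convertible_absorber (hF : F.IsRegularOfDegree r) (hr : 0 < r)
    (hG : HasCommonNeighbors G (3 * r) b) {x : W} (n₀ : F.neighborSet x) {X : Multiset (Sym2 V)}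
    {k : ℕ} (hcard : Multiset.card X = k * F.edgeFinset.card) (hdiag : ∀ e ∈ X, ¬ e.IsDiag)
    (hXR : ∀ e ∈ X, ∀ v ∈ e, v ∈ R) (hdiv : ∀ v, r ∣ X.countP fun e => v ∈ e) :
    Convertible F G b R (absorberCost r (Fintype.card W) F.edgeFinset.card k) X 0 := by
  -- Indexing the edges of `X` by `k` copies of the edge set of `F` lets the spokes left by
  -- `convertible_ports` be contracted in `k` blocks. The ports step consumes the edges `xs j, ys j`
  -- and creates spokes; contraction does the reverse. Only `X` disappears, so all edges at the new
  -- vertices act as catalysts.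
  let J := Fin k × F.edgeSet
  have hFc : Fintype.card F.edgeSet = F.edgeFinset.card := (SimpleGraph.edgeFinset_card).symm
  have hJ : Fintype.card J = k * F.edgeFinset.card := by
    rw [Fintype.card_prod, Fintype.card_fin, hFc]
  obtain ⟨a, c, rfl⟩ := exists_sum_eq (hJ.trans hcard.symm)
  have hmem : ∀ j, s(a j, c j) ∈ ∑ j, ({s(a j, c j)} : Multiset (Sym2 V)) := fun j =>
    Multiset.mem_sum.2 ⟨j, Finset.mem_univ _, Multiset.mem_singleton_self _⟩
  have hac : ∀ j, a j ≠ c j := fun j h => hdiag _ (hmem j) (by simpa using h)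
  have haR : ∀ j, a j ∈ R := fun j => hXR _ (hmem j) _ (Sym2.mem_mk_left _ _)
  have hcR : ∀ j, c j ∈ R := fun j => hXR _ (hmem j) _ (Sym2.mem_mk_right _ _)
  refine Convertible.of_fresh fun B hB hk => ?_
  obtain ⟨φ, -, hφB, hφ⟩ := exists_attached (X := Unit) (R := R) hG (fun _ => ∅) (by simp)
    (by simp) hB (by simp; omega)
  refine ⟨_, _, ?_, ?_, hφ, ?_⟩
  · simpa using hφB ()
  · exact Finset.card_image_le
  obtain ⟨p, hp⟩ : ∃ p, φ () = p := ⟨_, rfl⟩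
  have hpR : p ∉ R := fun h => hφB () (hp ▸ hB h)
  simp only [Finset.sum_empty, Finset.sum_const_zero, add_zero]
  rw [show Finset.univ.image φ = {p} by simp [hp]]
  have hap : ∀ j, a j ≠ p := fun j h => hpR (h ▸ haR j)
  have hcp : ∀ j, c j ≠ p := fun j h => hpR (h ▸ hcR j)
  refine Convertible.of_fresh fun B hB hk => ?_
  have hpS : p ∈ R ∪ {p} := by simp
  have hRS : ∀ v ∈ R, v ∈ R ∪ {p} := fun v hv => Finset.mem_union_left _ hv
  obtain ⟨xs, hxs, hxB, hxF⟩ := exists_attached (R := R ∪ {p}) hG (fun j => {a j, p})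
    (fun j => Finset.card_le_two.trans (by omega)) (fun j => by
      intro v hv
      rcases Finset.mem_insert.1 hv with rfl | hv
      exacts [hRS _ (haR j), Finset.mem_singleton.1 hv ▸ hpS]) hB (by rw [hJ]; omega)
  refine ⟨_, _, ?_, Finset.card_image_le.trans (by rw [Finset.card_univ, hJ]), hxF, ?_⟩
  · rw [Finset.disjoint_left]
    intro u hu
    obtain ⟨w, -, rfl⟩ := Finset.mem_image.1 hu
    exact hxB w
  have hxS : ∀ j, xs j ∉ R ∪ {p} := fun j h => hxB j (hB h)
  generalize hS : R ∪ {p} = S at *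
  set N := Finset.univ.image xs with hN
  have hxN : ∀ j, xs j ∈ S ∪ N := fun j =>
    Finset.mem_union_right _ (Finset.mem_image_of_mem _ (Finset.mem_univ _))
  have hSN : ∀ v ∈ S, v ∈ S ∪ N := fun v hv => Finset.mem_union_left _ hv
  refine Convertible.of_fresh fun B hB hk => ?_
  -- Three prescribed neighbours are the most that `3 * r` admits when `r = 1`.
  obtain ⟨ys, hys, hyB, hyF⟩ := exists_attached (R := S ∪ N) hG (fun j => {c j, p, xs j})
    (fun j => Finset.card_le_three.trans (by omega)) (fun j => by
      intro v hv
      simp only [Finset.mem_insert, Finset.mem_singleton] at hv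
      rcases hv with rfl | rfl | rfl
      exacts [hSN _ (hRS _ (hcR j)), hSN _ hpS, hxN j]) hB (by rw [hJ]; omega)
  refine ⟨_, _, ?_, Finset.card_image_le.trans (by rw [Finset.card_univ, hJ]), hyF, ?_⟩
  · rw [Finset.disjoint_left]
    intro u hu
    obtain ⟨w, -, rfl⟩ := Finset.mem_image.1 hu
    exact hyB w
  have hyS : ∀ j, ys j ∉ S ∪ N := fun j h => hyB j (hB h)
  set N' := Finset.univ.image ys with hN'
  have hyN : ∀ j, ys j ∈ S ∪ N ∪ N' := fun j =>
    Finset.mem_union_right _ (Finset.mem_image_of_mem _ (Finset.mem_univ _))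
  have hSN' : ∀ v ∈ S ∪ N, v ∈ S ∪ N ∪ N' := fun v hv => Finset.mem_union_left _ hv
  have hxy : ∀ i j, xs i ≠ ys j := fun i j h => hyS j (h ▸ hxN i)
  have hxp : ∀ i, xs i ≠ p := fun i h => hxS i (h ▸ hpS)
  have hyp : ∀ i, ys i ≠ p := fun i h => hyS i (h ▸ hSN _ hpS)
  have hxne : ∀ i, ∀ v ∈ R, xs i ≠ v := fun i v hv h => hxS i (h ▸ hRS _ hv)
  have hyne : ∀ i, ∀ v ∈ R, ys i ≠ v := fun i v hv h => hyS i (h ▸ hSN _ (hRS _ hv))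
  have c1 := convertible_ports (R := S ∪ N ∪ N') hF hr hG n₀ hxs hys hxy hac
    (hSN' _ (hSN _ hpS)) (fun j => hSN' _ (hSN _ (hRS _ (haR j))))
    (fun j => hSN' _ (hSN _ (hRS _ (hcR j)))) (fun j => hSN' _ (hxN j)) hyN
    (fun i j => hxne _ _ (haR j)) (fun i j => hxne _ _ (hcR j))
    (fun i j => hyne _ _ (haR j)) (fun i j => hyne _ _ (hcR j)) hxp hyp hap hcp hdiv
  have c2 := Convertible.sum (Finset.univ : Finset (Fin k))
    (P := fun t => ∑ e : F.edgeSet, ({s(p, xs (t, e))} + {s(p, ys (t, e))}))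
    (Q := fun t => ∑ e : F.edgeSet, {s(xs (t, e), ys (t, e))}) fun t _ =>
      convertible_contract (R := S ∪ N ∪ N') hF hr hG n₀ (xs := fun e => xs (t, e))
        (ys := fun e => ys (t, e)) (fun e e' h => (Prod.mk.inj (hxs h)).2)
        (fun e e' h => (Prod.mk.inj (hys h)).2) (fun i j => hxy _ _) (hSN' _ (hSN _ hpS))
        (fun j => hSN' _ (hxN _)) (fun j => hyN _) (fun i => hxp _) (fun i => hyp _)
  rw [← Fintype.sum_prod_type', ← Fintype.sum_prod_type', Finset.card_univ, Fintype.card_fin,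
    hFc] at c2
  have h := c1.add c2
  rw [hJ] at h
  have e1 : ∀ j, ∑ v ∈ ({a j, p} : Finset V), ({s(v, xs j)} : Multiset (Sym2 V)) =
      {s(a j, xs j)} + {s(p, xs j)} := fun j => Finset.sum_pair (hap j)
  have e2 : ∀ j, ∑ v ∈ ({c j, p, xs j} : Finset V), ({s(v, ys j)} : Multiset (Sym2 V)) =
      {s(c j, ys j)} + ({s(p, ys j)} + {s(xs j, ys j)}) := fun j => by
    rw [Finset.sum_insert, Finset.sum_pair (hxp j).symm]
    simp only [Finset.mem_insert, Finset.mem_singleton, not_or]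
    exact ⟨hcp j, (hxne j _ (hcR j)).symm⟩
  simp only [e1, e2, zero_add, Finset.sum_add_distrib] at h ⊢
  convert h using 1
  · abel
  · abel

end Absorber

/-! ### From sums of copies to decompositions -/

section Decomposition

variable {W V : Type*} [Fintype W] {F : SimpleGraph W} {r : ℕ}

/-- A multiset of edges that is a sum of copies of `F` and has no repetitions gives a
decomposition. -/
theorem exists_decomposition_of_mem_decomposable (K : SimpleGraph V) {T : Multiset (Sym2 V)}
    (hT : T ∈ decomposable F V) :
    T.Nodup → (∀ e ∈ T, e ∈ K.edgeSet) → ∃ D : Set K.Subgraph,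
      (∀ L ∈ D, Nonempty (F ≃g L.coe)) ∧
      (∀ L ∈ D, ∀ L' ∈ D, L ≠ L' → Disjoint L.edgeSet L'.edgeSet) ∧
      (⋃ L ∈ D, L.edgeSet) = {e | e ∈ T} := by
  induction hT using AddSubmonoid.closure_induction with
  | mem x hx =>
    obtain ⟨φ, hφ, rfl⟩ := hx
    intro _ hK
    let c : SimpleGraph.Copy F K := ⟨⟨φ, fun {a b} h =>
      hK _ (mem_copyEdges.2 ⟨a, b, h, rfl⟩)⟩, hφ⟩
    refine ⟨{c.toSubgraph}, ?_, ?_, ?_⟩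
    · rintro L rfl
      exact ⟨c.isoToSubgraph⟩
    · rintro L rfl L' rfl h
      exact (h rfl).elim
    · ext e
      simp only [Set.mem_singleton_iff, Set.iUnion_iUnion_eq_left, SimpleGraph.Subgraph.edgeSet_map,
        SimpleGraph.Subgraph.edgeSet_top]
      rw [copyEdges, Set.mem_image]
      constructor
      · rintro ⟨d, hd, rfl⟩
        exact Multiset.mem_map.2 ⟨d, by simpa using hd, rfl⟩
      · intro he
        obtain ⟨d, hd, rfl⟩ := Multiset.mem_map.1 he
        exact ⟨d, by simpa using hd, rfl⟩
  | zero => exact fun _ _ => ⟨∅, by simp, by simp, by simp⟩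
  | add x y _ _ hx hy =>
    intro hn hK
    obtain ⟨hnx, hny, hxy⟩ := Multiset.nodup_add.1 hn
    obtain ⟨D₁, i₁, d₁, u₁⟩ := hx hnx fun e he => hK e (Multiset.mem_add.2 (Or.inl he))
    obtain ⟨D₂, i₂, d₂, u₂⟩ := hy hny fun e he => hK e (Multiset.mem_add.2 (Or.inr he))
    have hd : ∀ L ∈ D₁, ∀ L' ∈ D₂, Disjoint L.edgeSet L'.edgeSet := by
      intro L hL L' hL'
      rw [Set.disjoint_left]
      intro e he he'
      have h1 : e ∈ {e | e ∈ x} := u₁ ▸ Set.mem_biUnion hL he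
      have h2 : e ∈ {e | e ∈ y} := u₂ ▸ Set.mem_biUnion hL' he'
      exact Multiset.disjoint_left.1 hxy h1 h2
    refine ⟨D₁ ∪ D₂, ?_, ?_, ?_⟩
    · rintro L (hL | hL)
      exacts [i₁ L hL, i₂ L hL]
    · rintro L (hL | hL) L' (hL' | hL') hne
      exacts [d₁ L hL L' hL' hne, hd L hL L' hL', (hd L' hL' L hL).symm, d₂ L hL L' hL' hne]
    · rw [Set.biUnion_union, u₁, u₂]
      ext e
      simp

theorem hasDecomposition_of_mem_decomposable [Fintype V] {K : SimpleGraph V}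
    (h : K.edgeFinset.val ∈ decomposable F V) : HasDecomposition F K := by
  obtain ⟨D, h₁, h₂, h₃⟩ := exists_decomposition_of_mem_decomposable K h K.edgeFinset.nodup
    (fun e he => by simpa using he)
  refine ⟨D, h₁, h₂, h₃.trans ?_⟩
  ext e
  simp

theorem isDivisible_of_mem_decomposable [Fintype V] [Nonempty W] (hF : F.IsRegularOfDegree r)
    {K : SimpleGraph V} (h : K.edgeFinset.val ∈ decomposable F V) : IsDivisible F K := by
  refine ⟨dvd_card_of_decomposable h, ?_⟩
  have h1 : degreeGcd F ∣ r := by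
    obtain ⟨x⟩ := ‹Nonempty W›
    have := Finset.gcd_dvd (f := fun w => F.degree w) (Finset.mem_univ x)
    rwa [hF.degree_eq] at this
  refine h1.trans (Finset.dvd_gcd fun v _ => ?_)
  rw [← countP_mem_edgeFinset]
  exact dvd_countP_of_decomposable hF h v

theorem IsDivisible.dvd_degree [Fintype V] (hF : F.IsRegularOfDegree r) {K : SimpleGraph V}
    (h : IsDivisible F K) (v : V) : r ∣ K.degree v := by
  have h1 : r ∣ degreeGcd F := Finset.dvd_gcd fun w _ => (hF.degree_eq w).symm ▸ dvd_rfl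
  exact (h1.trans h.2).trans (Finset.gcd_dvd (Finset.mem_univ v))

end Decomposition

/-! ### Edge-disjoint greedy choice and common neighbours -/

section Counting

variable {V : Type*}

theorem card_filter_mem_sym2_le [Fintype V] (e : Sym2 V) :
    (Finset.univ.filter fun v => v ∈ e).card ≤ 2 := by
  induction e with
  | _ a b =>
    refine (Finset.card_le_card (t := {a, b}) fun v hv => ?_).trans Finset.card_le_two
    simpa [Sym2.mem_iff] using hv

theorem sum_countP_mem_le [Fintype V] (T : Multiset (Sym2 V)) :
    ∑ v, T.countP (fun e => v ∈ e) ≤ 2 * Multiset.card T := by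
  induction T using Multiset.induction_on with
  | empty => simp
  | cons e T ih =>
    simp only [Multiset.countP_cons, Finset.sum_add_distrib, Multiset.card_cons]
    have := card_filter_mem_sym2_le e
    rw [Finset.card_filter] at this
    omega

theorem sum_countP_mem [Fintype V] {T : Multiset (Sym2 V)} (hT : ∀ e ∈ T, ¬ e.IsDiag) :
    ∑ v, T.countP (fun e => v ∈ e) = 2 * Multiset.card T := by
  induction T using Multiset.induction_on with
  | empty => simp
  | cons e T ih =>
    simp only [Multiset.countP_cons, Finset.sum_add_distrib, Multiset.card_cons]
    rw [ih fun d hd => hT d (Multiset.mem_cons_of_mem hd), ← Finset.card_filter]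
    have : (Finset.univ.filter fun v => v ∈ e).card = 2 := by
      have he := hT e (Multiset.mem_cons_self _ _)
      induction e with
      | _ a b =>
        rw [← Finset.card_pair (a := a) (b := b) (by simpa using he)]
        congr 1
        ext v
        simp [Sym2.mem_iff]
    omega

variable {G : SimpleGraph V} {R N : Finset V} {T : Multiset (Sym2 V)}

theorem Fresh.toFinset_subset (h : Fresh G R N T) :
    T.toFinset ⊆ ((R ∪ N) ×ˢ (R ∪ N)).image fun q => s(q.1, q.2) := by
  intro e he
  have hs := h.subset e (Multiset.mem_toFinset.1 he)
  induction e with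
  | _ a b =>
    exact Finset.mem_image.2 ⟨(a, b), Finset.mem_product.2
      ⟨Finset.mem_union.2 (hs a (by simp)), Finset.mem_union.2 (hs b (by simp))⟩, rfl⟩

theorem Fresh.card_le (h : Fresh G R N T) : Multiset.card T ≤ (R.card + N.card) ^ 2 := by
  rw [← Multiset.toFinset_card_of_nodup h.nodup]
  refine (Finset.card_le_card h.toFinset_subset).trans (Finset.card_image_le.trans ?_)
  rw [Finset.card_product, sq]
  exact Nat.mul_le_mul (Finset.card_union_le _ _) (Finset.card_union_le _ _)

theorem Fresh.countP_le (h : Fresh G R N T) (v : V) :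
    T.countP (fun e => v ∈ e) ≤ R.card + N.card := by
  rw [Multiset.countP_eq_card_filter, ← Multiset.toFinset_card_of_nodup (h.nodup.filter _)]
  refine (Finset.card_le_card (t := (R ∪ N).image fun w => s(v, w)) fun e he => ?_).trans
    (Finset.card_image_le.trans (Finset.card_union_le _ _))
  rw [Multiset.mem_toFinset, Multiset.mem_filter] at he
  obtain ⟨he, w, rfl⟩ := he
  exact Finset.mem_image_of_mem _ (Finset.mem_union.2 (h.subset _ he w (Sym2.mem_mk_right _ _)))

theorem Fresh.countP_eq_zero (h : Fresh G R N T) {v : V} (hR : v ∉ R) (hN : v ∉ N) :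
    T.countP (fun e => v ∈ e) = 0 :=
  Multiset.countP_eq_zero.2 fun e he hv => (h.subset e he v hv).elim hR hN

/-- Greedy choice of edge-disjoint objects of bounded degree in `G`: each vertex is a root of few
objects, and the new vertices can be chosen among the vertices of small degree. -/
theorem exists_edgeDisjoint_family [Fintype V] {ι : Type*} (s : Finset ι) (R : ι → Finset V)
    (Φ : ι → Multiset (Sym2 V) → Prop) {k ρ₀ K b θ β ρ : ℕ} (hK : ρ₀ + k = K) (hθ : 0 < θ)
    (hR : ∀ i ∈ s, (R i).card ≤ ρ₀) (hρ : ∀ v, (s.filter fun i => v ∈ R i).card ≤ ρ)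
    (hβ : 2 * (s.card * K ^ 2) ≤ β * θ) (hb : β + K ≤ b)
    (hstep : ∀ i ∈ s, ∀ E : Multiset (Sym2 V),
      (∀ v, E.countP (fun e => v ∈ e) ≤ θ + K + K * ρ) → ∀ B : Finset V, R i ⊆ B →
      B.card + k ≤ b → ∃ (N : Finset V) (T : Multiset (Sym2 V)), Disjoint N B ∧ N.card ≤ k ∧
        Fresh G (R i) N T ∧ (∀ e ∈ T, e ∉ E) ∧ Φ i T) :
    ∃ T : ι → Multiset (Sym2 V), (∀ i ∈ s, Φ i (T i)) ∧ (∑ i ∈ s, T i).Nodup ∧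
      (∀ e ∈ ∑ i ∈ s, T i, e ∈ G.edgeSet) ∧
      ∀ v, (∑ i ∈ s, T i).countP (fun e => v ∈ e) ≤ θ + K + K * ρ := by
  suffices H : ∀ u ⊆ s, ∃ T : ι → Multiset (Sym2 V), (∀ i ∈ u, Φ i (T i)) ∧
      (∑ i ∈ u, T i).Nodup ∧ (∀ e ∈ ∑ i ∈ u, T i, e ∈ G.edgeSet) ∧
      (∀ v, (∑ i ∈ u, T i).countP (fun e => v ∈ e) ≤
        θ + K + K * (u.filter fun i => v ∈ R i).card) ∧
      Multiset.card (∑ i ∈ u, T i) ≤ u.card * K ^ 2 by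
    obtain ⟨T, h₁, h₂, h₃, h₄, -⟩ := H s subset_rfl
    exact ⟨T, h₁, h₂, h₃, fun v => (h₄ v).trans
      (Nat.add_le_add_left (Nat.mul_le_mul_left _ (hρ v)) _)⟩
  intro u
  induction u using Finset.induction_on with
  | empty => exact fun _ => ⟨fun _ => 0, by simp, by simp, by simp, by simp, by simp⟩
  | insert i u hi ih =>
    intro hu
    have his : i ∈ s := hu (Finset.mem_insert_self _ _)
    have hus : u ⊆ s := (Finset.subset_insert _ _).trans hu
    obtain ⟨T, h₁, h₂, h₃, h₄, h₅⟩ := ih hus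
    set E := ∑ i ∈ u, T i with hE
    -- Vertices already meeting `θ` chosen edges are barred as new vertices; the degree sum bounds
    -- their number by `β`. A vertex below `θ` gains at most `K` when chosen as a new vertex, so it
    -- can exceed `θ + K` only through objects rooted at it, each adding at most `K`.
    let bad : Finset V := Finset.univ.filter fun v => θ ≤ E.countP fun e => v ∈ e
    have hbad : bad.card ≤ β := by
      refine Nat.le_of_mul_le_mul_right ?_ hθ
      calc bad.card * θ ≤ ∑ v ∈ bad, E.countP (fun e => v ∈ e) := by
            rw [← smul_eq_mul]
            exact Finset.card_nsmul_le_sum _ _ _ fun v hv => (Finset.mem_filter.1 hv).2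
        _ ≤ ∑ v, E.countP (fun e => v ∈ e) :=
            Finset.sum_le_sum_of_subset (Finset.subset_univ _)
        _ ≤ 2 * Multiset.card E := sum_countP_mem_le E
        _ ≤ 2 * (s.card * K ^ 2) := Nat.mul_le_mul_left _ (h₅.trans
            (Nat.mul_le_mul_right _ (Finset.card_le_card hus)))
        _ ≤ β * θ := hβ
    obtain ⟨N, S, hNB, hNk, hF, hSE, hΦ⟩ := hstep i his E (fun v => (h₄ v).trans
      (Nat.add_le_add_left (Nat.mul_le_mul_left _ ((Finset.card_le_card
        (Finset.filter_subset_filter _ hus)).trans (hρ v))) _)) (R i ∪ bad)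
      Finset.subset_union_left (by
        have := Finset.card_union_le (R i) bad
        have := hR i his
        omega)
    have hKc : (R i).card + N.card ≤ K := hK ▸ Nat.add_le_add (hR i his) hNk
    have hsum : ∑ j ∈ insert i u, Function.update T i S j = S + E := by
      rw [Finset.sum_insert hi, Function.update_self]
      congr 1
      exact Finset.sum_congr rfl fun j hj => Function.update_of_ne (ne_of_mem_of_not_mem hj hi) _ _
    refine ⟨Function.update T i S, ?_, ?_, ?_, ?_, ?_⟩
    · intro j hj
      rcases Finset.mem_insert.1 hj with rfl | hj
      · simpa using hΦ
      · rw [Function.update_of_ne (ne_of_mem_of_not_mem hj hi)]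
        exact h₁ j hj
    · rw [hsum]
      exact Multiset.nodup_add.2 ⟨hF.nodup, h₂, Multiset.disjoint_left.2 fun {e} he => hSE e he⟩
    · rw [hsum]
      intro e he
      rcases Multiset.mem_add.1 he with he | he
      exacts [hF.mem_edgeSet e he, h₃ e he]
    · intro v
      rw [hsum, Multiset.countP_add]
      have hle : (u.filter fun j => v ∈ R j).card ≤
          ((insert i u).filter fun j => v ∈ R j).card :=
        Finset.card_le_card (Finset.filter_subset_filter _ (Finset.subset_insert _ _))
      have h4 := h₄ v
      have h6 := hF.countP_le v
      by_cases hv : v ∈ R i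
      · rw [Finset.filter_insert, if_pos hv, Finset.card_insert_of_notMem (by simp [hi]), mul_add]
        omega
      · by_cases hvN : v ∈ N
        · have : v ∉ bad := fun h => Finset.disjoint_left.1 hNB hvN (Finset.mem_union_right _ h)
          simp only [bad, Finset.mem_filter, Finset.mem_univ, true_and, not_le] at this
          omega
        · rw [hF.countP_eq_zero hv hvN]
          have := Nat.mul_le_mul_left K hle
          omega
    · rw [hsum, Multiset.card_add, Finset.card_insert_of_notMem hi, add_mul, one_mul, add_comm]
      exact Nat.add_le_add h₅ (hF.card_le.trans (Nat.pow_le_pow_left hKc 2))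

/-- A vertex is not adjacent to at most `a` vertices of `G`, itself included, and the deletion adds
at most `d`. So `k` vertices exclude at most `k * (a + d)` candidates, and fewer than `b` further
exclusions leave one. -/
theorem hasCommonNeighbors_deleteEdges [Fintype V] {a d k b : ℕ}
    (hG : ∀ v, Fintype.card V ≤ G.degree v + a)
    {E : Multiset (Sym2 V)} (hE : ∀ v, E.countP (fun e => v ∈ e) ≤ d)
    (hb : k * (a + d) + b ≤ Fintype.card V) :
    HasCommonNeighbors (G.deleteEdges {e | e ∈ E}) k b := by
  intro S B hS hB
  have hnon : ∀ v, (Finset.univ.filter fun w => ¬ (G.deleteEdges {e | e ∈ E}).Adj v w).card ≤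
      a + d := by
    intro v
    refine (Finset.card_le_card (t := (G.neighborFinset v)ᶜ ∪
      Finset.univ.filter fun w => s(v, w) ∈ E) fun w hw => ?_).trans
      ((Finset.card_union_le _ _).trans (Nat.add_le_add ?_ ?_))
    · simp only [SimpleGraph.deleteEdges_adj, Finset.mem_filter, Finset.mem_univ, true_and] at hw
      by_cases h : G.Adj v w
      · refine Finset.mem_union_right _ (Finset.mem_filter.2 ⟨Finset.mem_univ _, ?_⟩)
        by_contra h'
        exact hw ⟨h, h'⟩
      · exact Finset.mem_union_left _ (by simpa using h)
    · rw [Finset.card_compl, SimpleGraph.card_neighborFinset_eq_degree]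
      have := hG v
      omega
    · refine le_trans ?_ (hE v)
      rw [Multiset.countP_eq_card_filter]
      refine le_trans ?_ (Multiset.toFinset_card_le _)
      refine Finset.card_le_card_of_injOn (fun w => s(v, w)) (fun w hw => ?_)
        fun w _ w' _ h => Sym2.congr_right.1 h
      have hw : s(v, w) ∈ E := by simpa using hw
      simp [hw]
  by_contra! hcon
  have hcover : (Finset.univ : Finset V) ⊆ B ∪ S.biUnion fun v =>
      Finset.univ.filter fun w => ¬ (G.deleteEdges {e | e ∈ E}).Adj v w := by
    intro w _
    by_cases hw : w ∈ B
    · exact Finset.mem_union_left _ hw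
    · obtain ⟨v, hv, h⟩ := hcon w hw
      exact Finset.mem_union_right _ (Finset.mem_biUnion.2
        ⟨v, hv, Finset.mem_filter.2 ⟨Finset.mem_univ _, h⟩⟩)
  have h1 := (Finset.card_le_card hcover).trans ((Finset.card_union_le _ _).trans
    (Nat.add_le_add_left (Finset.card_biUnion_le_card_mul _ _ _ fun v _ => hnon v) _))
  rw [Finset.card_univ] at h1
  have := Nat.mul_le_mul_right (a + d) hS
  omega

end Counting

/-! ### Carriers: divisible graphs that shift the number of edges -/

section Carrier

variable {W V : Type*} [Fintype W] {F : SimpleGraph W} {G : SimpleGraph V} {b r : ℕ}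

/-- The graph obtained from `g` disjoint copies of `F` by replacing the edge `xy` in each copy by
edges from `x` and `y` to a common new vertex. -/
def loopGraph (F : SimpleGraph W) (x y : W) (g : ℕ) : SimpleGraph (Option (Fin g × W)) where
  Adj
    | none, none => False
    | none, some (_, w) => w = x ∨ w = y
    | some (_, w), none => w = x ∨ w = y
    | some (j, w), some (j', w') => j = j' ∧ F.Adj w w' ∧ s(w, w') ≠ s(x, y)
  symm := ⟨by
    rintro (_ | ⟨j, w⟩) (_ | ⟨j', w'⟩) h
    · exact h
    · exact h
    · exact h
    · exact ⟨h.1.symm, h.2.1.symm, by rw [Sym2.eq_swap]; exact h.2.2⟩⟩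
  loopless := ⟨by
    rintro (_ | ⟨j, w⟩) h
    · exact h
    · exact h.2.1.ne rfl⟩

theorem degree_loopGraph_none {x y : W} (hxy : x ≠ y) (g : ℕ) :
    (loopGraph F x y g).degree none = 2 * g := by
  have h : (loopGraph F x y g).neighborFinset none =
      ((Finset.univ : Finset (Fin g)) ×ˢ ({x, y} : Finset W)).image some := by
    ext o
    rw [SimpleGraph.mem_neighborFinset]
    rcases o with _ | ⟨j, w⟩
    · simp
    · simp [loopGraph]
  rw [← SimpleGraph.card_neighborFinset_eq_degree, h,
    Finset.card_image_of_injective _ (Option.some_injective _), Finset.card_product,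
    Finset.card_pair hxy, Finset.card_univ, Fintype.card_fin, mul_comm]

theorem degree_loopGraph_some {x y : W} (hxy : F.Adj x y) {g : ℕ} (q : Fin g × W) :
    (loopGraph F x y g).degree (some q) = F.degree q.2 := by
  obtain ⟨j, w⟩ := q
  let ψ : W → Option (Fin g × W) := fun w' => if s(w, w') = s(x, y) then none else some (j, w')
  have h : (loopGraph F x y g).neighborFinset (some (j, w)) = (F.neighborFinset w).image ψ := by
    ext o
    rw [SimpleGraph.mem_neighborFinset, Finset.mem_image]
    simp only [SimpleGraph.mem_neighborFinset, ψ]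
    rcases o with _ | ⟨j', w'⟩
    · constructor
      · rintro (rfl | rfl)
        · exact ⟨y, hxy, if_pos rfl⟩
        · exact ⟨x, hxy.symm, if_pos Sym2.eq_swap⟩
      · rintro ⟨w', -, h⟩
        split_ifs at h with h'
        exact (Sym2.eq_iff.1 h').imp And.left And.left
    · constructor
      · rintro ⟨rfl, h, h'⟩
        exact ⟨w', h, if_neg h'⟩
      · rintro ⟨u, hu, h⟩
        split_ifs at h with h'
        obtain ⟨rfl, rfl⟩ := Prod.mk.inj (Option.some.inj h)
        exact ⟨rfl, hu, h'⟩
  rw [← SimpleGraph.card_neighborFinset_eq_degree, h, Finset.card_image_of_injOn,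
    SimpleGraph.card_neighborFinset_eq_degree]
  intro u _ u' _ huu
  simp only [ψ] at huu
  split_ifs at huu with h1 h2
  · exact Sym2.congr_right.1 (h1.trans h2.symm)
  · exact (Prod.mk.inj (Option.some.inj huu)).2

theorem card_edgeFinset_loopGraph {x y : W} (hxy : F.Adj x y) (g : ℕ) :
    (loopGraph F x y g).edgeFinset.card = g * (1 + F.edgeFinset.card) := by
  have h := (loopGraph F x y g).sum_degrees_eq_twice_card_edges
  have h' := F.sum_degrees_eq_twice_card_edges
  rw [Fintype.sum_option, degree_loopGraph_none hxy.ne, Fintype.sum_prod_type] at h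
  have h2 : ∀ (j : Fin g) w, (loopGraph F x y g).degree (some (j, w)) = F.degree w := fun j w =>
    degree_loopGraph_some hxy (j, w)
  simp only [h2] at h
  rw [h', Finset.sum_const, Finset.card_univ, Fintype.card_fin, smul_eq_mul] at h
  have : 2 * (loopGraph F x y g).edgeFinset.card = 2 * (g * (1 + F.edgeFinset.card)) := by
    rw [← h]; ring
  omega

/-- A copy of `loopGraph` has degrees `r` and `2 * g`, and its number of edges is congruent to `g`
modulo `e(F)`. Carriers thus correct edge counts in steps of `g` without disturbing divisibility of
the degrees. -/
theorem exists_fresh_carrier (hF : F.IsRegularOfDegree r) (hG : HasCommonNeighbors G (3 * r) b)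
    {x y : W} (hxy : F.Adj x y) {g : ℕ} (hg : r ∣ 2 * g) (hgr : g ≤ r) (B : Finset V)
    (hB : B.card + (1 + g * Fintype.card W) ≤ b) :
    ∃ (N : Finset V) (T : Multiset (Sym2 V)), Disjoint N B ∧ N.card ≤ 1 + g * Fintype.card W ∧
      Fresh G ∅ N T ∧ (∀ v, r ∣ T.countP fun e => v ∈ e) ∧
      Multiset.card T = g * (1 + F.edgeFinset.card) := by
  have hc : Fintype.card (Option (Fin g × W)) = 1 + g * Fintype.card W := by
    rw [Fintype.card_option, Fintype.card_prod, Fintype.card_fin, add_comm]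
  have hdeg : ∀ o, (loopGraph F x y g).degree o = 2 * g ∨ (loopGraph F x y g).degree o = r := by
    rintro (_ | q)
    · exact Or.inl (degree_loopGraph_none hxy.ne g)
    · exact Or.inr ((degree_loopGraph_some hxy q).trans (hF.degree_eq _))
  obtain ⟨φ, hφ, hφB, -, hφrel⟩ := hG.exists_embedding (fun _ => ∅) (loopGraph F x y g)
    (fun o => by
      rw [Finset.card_empty]
      rcases hdeg o with h | h <;> omega) B (by rwa [hc])
  have hN : ∀ o, φ o ∈ Finset.univ.image φ := fun o =>
    Finset.mem_image_of_mem _ (Finset.mem_univ _)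
  refine ⟨Finset.univ.image φ, copyEdges (loopGraph F x y g) φ, ?_,
    Finset.card_image_le.trans (by rw [Finset.card_univ, hc]), ⟨copyEdges_nodup _ hφ, ?_, ?_, ?_⟩,
    ?_, ?_⟩
  · rw [Finset.disjoint_left]
    intro u hu
    obtain ⟨w, -, rfl⟩ := Finset.mem_image.1 hu
    exact hφB w
  · intro e he
    obtain ⟨u, u', h, rfl⟩ := mem_copyEdges.1 he
    exact hφrel _ _ h
  · intro e he
    obtain ⟨u, u', h, rfl⟩ := mem_copyEdges.1 he
    exact ⟨_, Sym2.mem_mk_left _ _, hN _⟩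
  · intro e he z hz
    obtain ⟨u, u', h, rfl⟩ := mem_copyEdges.1 he
    rcases Sym2.mem_iff.1 hz with rfl | rfl
    exacts [Or.inr (hN _), Or.inr (hN _)]
  · exact dvd_countP_copyEdges (fun o => by rcases hdeg o with h | h <;> rw [h]; exact hg) hφ
  · rw [card_copyEdges, card_edgeFinset_loopGraph hxy]

/-- Here `g` is `r / 2` for even `r` and `r` for odd `r`. By the handshake lemma it divides the
number of edges of every graph whose degrees are divisible by `r`. -/
theorem exists_unit_dvd (hr : 0 < r) :
    ∃ g, 0 < g ∧ g ≤ r ∧ r ∣ 2 * g ∧ ∀ h, r ∣ 2 * h → g ∣ h := by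
  rcases Nat.even_or_odd r with ⟨c, hc⟩ | hodd
  · refine ⟨c, by omega, by omega, by rw [hc, two_mul], fun h hh => ?_⟩
    rw [hc, ← two_mul] at hh
    exact Nat.dvd_of_mul_dvd_mul_left two_pos hh
  · exact ⟨r, hr, le_rfl, dvd_mul_left _ _, fun h hh =>
      (Nat.Coprime.dvd_mul_left (Nat.coprime_two_right.2 hodd)).1 hh⟩

end Carrier

/-! ### Absorbers for all tasks, and the carriers -/

section Tasks

variable {W V : Type*} [Fintype W] [Fintype V] {F : SimpleGraph W} {G : SimpleGraph V} {r : ℕ}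

/-- The vertices of the edges in `T`. -/
noncomputable def supp (T : Multiset (Sym2 V)) : Finset V :=
  Finset.univ.filter fun v => 0 < T.countP fun e => v ∈ e

theorem mem_supp {T : Multiset (Sym2 V)} {e : Sym2 V} (he : e ∈ T) {v : V} (hv : v ∈ e) :
    v ∈ supp T :=
  Finset.mem_filter.2 ⟨Finset.mem_univ _, Multiset.countP_pos.2 ⟨e, he, hv⟩⟩

theorem card_supp_le (T : Multiset (Sym2 V)) : (supp T).card ≤ 2 * Multiset.card T := by
  refine le_trans ?_ (sum_countP_mem_le T)
  rw [supp, Finset.card_filter]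
  exact Finset.sum_le_sum fun v _ => by split_ifs <;> omega

theorem card_filter_mem_supp_le {ι : Type*} (s : Finset ι) (C : ι → Multiset (Sym2 V)) (v : V) :
    (s.filter fun i => v ∈ supp (C i)).card ≤ (∑ i ∈ s, C i).countP fun e => v ∈ e := by
  rw [countP_sum, Finset.card_filter]
  refine Finset.sum_le_sum fun i _ => ?_
  split_ifs with h
  · exact (Finset.mem_filter.1 h).2
  · exact Nat.zero_le _

/-- The edge set `t.1` of a graph on one part, together with the first `t.2.1` carriers before
that part, and all but the first `t.2.2` carriers after that part. -/
noncomputable def exchange (C : ℕ → ℕ → Multiset (Sym2 V)) (d i : ℕ)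
    (t : Finset (Sym2 V) × ℕ × ℕ) : Multiset (Sym2 V) :=
  t.1.val + ∑ l ∈ Finset.range t.2.1, C i l + ∑ l ∈ Finset.Ico t.2.2 d, C (i + 1) l

/-- The multisets of edges that have to be absorbed at the part `S i`. -/
noncomputable def tasks (F : SimpleGraph W) (r : ℕ) (S : ℕ → Finset V)
    (C : ℕ → ℕ → Multiset (Sym2 V)) (d i : ℕ) : Finset (Finset (Sym2 V) × ℕ × ℕ) :=
  (((S i ×ˢ S i).image fun q => s(q.1, q.2)).powerset ×ˢ
    (Finset.range (d + 1) ×ˢ Finset.range (d + 1))).filter fun t =>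
      (∀ e ∈ t.1, ¬ e.IsDiag) ∧ (∀ v, r ∣ (exchange C d i t).countP fun e => v ∈ e) ∧
        F.edgeFinset.card ∣ Multiset.card (exchange C d i t)

theorem card_edges_le {V : Type*} {S : Finset V} {m : ℕ} (hS : S.card ≤ m) :
    ((S ×ˢ S).image fun q => s(q.1, q.2)).card ≤ m * m :=
  Finset.card_image_le.trans (by rw [Finset.card_product]; exact Nat.mul_le_mul hS hS)

theorem card_tasks_le {S : ℕ → Finset V} {C : ℕ → ℕ → Multiset (Sym2 V)} {d i m : ℕ}
    (hS : (S i).card ≤ m) :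
    (tasks F r S C d i).card ≤ 2 ^ (m * m) * ((d + 1) * (d + 1)) := by
  refine (Finset.card_filter_le _ _).trans ?_
  rw [Finset.card_product, Finset.card_product, Finset.card_powerset, Finset.card_range]
  exact Nat.mul_le_mul_right _ (Nat.pow_le_pow_right two_pos (card_edges_le hS))

theorem portsCost_mono {r f h h' : ℕ} (hh : h ≤ h') : portsCost r f h ≤ portsCost r f h' := by
  unfold portsCost
  gcongr

theorem absorberCost_mono {r f D D' k k' : ℕ} (hD : D ≤ D') (hk : k ≤ k') :
    absorberCost r f D k ≤ absorberCost r f D' k' := by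
  have h1 : k * D ≤ k' * D' := Nat.mul_le_mul hk hD
  have h2 : portsCost r f (k * D) ≤ portsCost r f (k' * D') := portsCost_mono h1
  have h3 : portsCost r f D ≤ portsCost r f D' := portsCost_mono hD
  unfold absorberCost
  gcongr

/-- Simultaneous choice of edge-disjoint absorbers for all tasks. -/
theorem exists_absorbers (hF : F.IsRegularOfDegree r) (hr : 0 < r) {x : W}
    (n₀ : F.neighborSet x) {S : ℕ → Finset V} {C : ℕ → ℕ → Multiset (Sym2 V)}
    {q m d cC d₁ ρ₀ k K M ρ θ β a b : ℕ} (hS : ∀ i, (S i).card ≤ m)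
    (hSd : ∀ i j v, v ∈ S i → v ∈ S j → i = j)
    (hCc : ∀ i ≤ q, ∀ l < d, Multiset.card (C i l) = cC)
    (hCG : ∀ i ≤ q, ∀ l < d, ∀ e ∈ C i l, e ∈ G.edgeSet)
    (hCd : ∀ v, (∑ i ∈ Finset.range (q + 1), ∑ l ∈ Finset.range d, C i l).countP
      (fun e => v ∈ e) ≤ d₁)
    (hρ₀ : m + 4 * (d * cC) ≤ ρ₀)
    (hk : absorberCost r (Fintype.card W) F.edgeFinset.card (m * m + 2 * (d * cC)) ≤ k)
    (hK : ρ₀ + k = K) (hM : 2 ^ (m * m) * ((d + 1) * (d + 1)) ≤ M) (hρ : (1 + 2 * d₁) * M ≤ ρ)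
    (hG : ∀ v, Fintype.card V ≤ G.degree v + a)
    (hn : 3 * r * (a + (d₁ + (θ + K + K * ρ))) + b ≤ Fintype.card V)
    (hβ : 2 * (q * M * K ^ 2) ≤ β * θ) (hb : β + K ≤ b) (hθ : 0 < θ) :
    ∃ T : (Σ _ : ℕ, Finset (Sym2 V) × ℕ × ℕ) → Multiset (Sym2 V),
      (∀ i < q, ∀ t ∈ tasks F r S C d i, T ⟨i, t⟩ ∈ decomposable F V ∧
        T ⟨i, t⟩ + exchange C d i t ∈ decomposable F V ∧
        ∀ e ∈ T ⟨i, t⟩, e ∉ ∑ i ∈ Finset.range (q + 1), ∑ l ∈ Finset.range d, C i l) ∧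
      (∑ u ∈ (Finset.range q).sigma (tasks F r S C d), T u).Nodup ∧
      (∀ e ∈ ∑ u ∈ (Finset.range q).sigma (tasks F r S C d), T u, e ∈ G.edgeSet) ∧
      ∀ v, (∑ u ∈ (Finset.range q).sigma (tasks F r S C d), T u).countP (fun e => v ∈ e) ≤
        θ + K + K * ρ := by
  set E₀ := ∑ i ∈ Finset.range (q + 1), ∑ l ∈ Finset.range d, C i l with hE₀
  let CC : ℕ → Multiset (Sym2 V) := fun i => ∑ l ∈ Finset.range d, C i l
  -- An absorber for part `i` is rooted at the part and at the carriers on both sides of it. Parts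
  -- are disjoint and at most `d₁` carrier edges meet a vertex, so a vertex lies in at most `1 + 2 *
  -- d₁` of these sets, each serving at most `M` tasks.
  let root : ℕ → Finset V := fun i => S i ∪ (supp (CC i) ∪ supp (CC (i + 1)))
  have hCCc : ∀ i ≤ q, Multiset.card (CC i) = d * cC := by
    intro i hi
    rw [Multiset.card_sum, Finset.sum_congr rfl fun l hl => hCc i hi l (Finset.mem_range.1 hl),
      Finset.sum_const, Finset.card_range, smul_eq_mul]
  have hroot : ∀ i < q, (root i).card ≤ ρ₀ := by
    intro i hi
    have h1 := Finset.card_union_le (S i) (supp (CC i) ∪ supp (CC (i + 1)))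
    have h2 := Finset.card_union_le (supp (CC i)) (supp (CC (i + 1)))
    have h3 := card_supp_le (CC i)
    have h4 := card_supp_le (CC (i + 1))
    rw [hCCc i hi.le] at h3
    rw [hCCc (i + 1) hi] at h4
    have h5 := hS i
    change (S i ∪ (supp (CC i) ∪ supp (CC (i + 1)))).card ≤ ρ₀
    omega
  have hcount : ∀ v, ((Finset.range q).filter fun i => v ∈ root i).card ≤ 1 + 2 * d₁ := by
    intro v
    have h0 : ((Finset.range (q + 1)).filter fun i => v ∈ supp (CC i)).card ≤ d₁ :=
      (card_filter_mem_supp_le _ CC v).trans (hCd v)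
    have h1 : ((Finset.range q).filter fun i => v ∈ S i).card ≤ 1 := by
      refine Finset.card_le_one.2 fun i hi j hj => ?_
      exact hSd i j v (Finset.mem_filter.1 hi).2 (Finset.mem_filter.1 hj).2
    have h2 : ((Finset.range q).filter fun i => v ∈ supp (CC i)).card ≤ d₁ :=
      (Finset.card_le_card (Finset.filter_subset_filter _
        (Finset.range_subset_range.2 (Nat.le_succ q)))).trans h0
    have h3 : ((Finset.range q).filter fun i => v ∈ supp (CC (i + 1))).card ≤ d₁ := by
      refine (Finset.card_le_card_of_injOn (fun i => i + 1) (fun i hi => ?_)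
        (fun i _ j _ h => Nat.succ.inj h)).trans h0
      simp only [Finset.coe_filter, Finset.mem_range, Set.mem_ofPred_eq] at hi ⊢
      exact ⟨by omega, hi.2⟩
    have h4 : ((Finset.range q).filter fun i => v ∈ root i) ⊆
        ((Finset.range q).filter fun i => v ∈ S i) ∪
          (((Finset.range q).filter fun i => v ∈ supp (CC i)) ∪
            ((Finset.range q).filter fun i => v ∈ supp (CC (i + 1)))) := by
      intro i hi
      simp only [root, Finset.mem_filter, Finset.mem_union] at hi ⊢
      tauto
    refine (Finset.card_le_card h4).trans ((Finset.card_union_le _ _).trans ?_)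
    have := Finset.card_union_le ((Finset.range q).filter fun i => v ∈ supp (CC i))
      ((Finset.range q).filter fun i => v ∈ supp (CC (i + 1)))
    omega
  have hMi : ∀ i, (tasks F r S C d i).card ≤ M := fun i => (card_tasks_le (hS i)).trans hM
  have hscard : ∀ u : Finset ℕ, (u.sigma (tasks F r S C d)).card ≤ u.card * M := by
    intro u
    rw [Finset.card_sigma]
    exact Finset.sum_le_card_nsmul _ _ _ fun i _ => hMi i
  obtain ⟨T, hT, hT₁, hT₂, hT₃⟩ := exists_edgeDisjoint_family (G := G)
    ((Finset.range q).sigma (tasks F r S C d)) (fun u => root u.1)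
    (fun u T => T ∈ decomposable F V ∧ T + exchange C d u.1 u.2 ∈ decomposable F V ∧
      ∀ e ∈ T, e ∉ E₀) (k := k) (ρ₀ := ρ₀) (K := K) (b := b) (θ := θ) (β := β) (ρ := ρ) hK hθ
    (fun u hu => hroot _ (Finset.mem_range.1 (Finset.mem_sigma.1 hu).1))
    (by
      intro v
      refine le_trans ?_ ((Nat.mul_le_mul_right _ (hcount v)).trans hρ)
      refine le_trans (Finset.card_le_card ?_) (hscard _)
      intro u hu
      simp only [Finset.mem_filter, Finset.mem_sigma] at hu ⊢
      exact ⟨⟨hu.1.1, hu.2⟩, hu.1.2⟩)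
    (by
      refine le_trans (Nat.mul_le_mul_left _ (Nat.mul_le_mul_right _ ?_)) hβ
      simpa using hscard (Finset.range q)) hb (by
      rintro ⟨i, t⟩ hu E hE B hB hBk
      obtain ⟨hi, ht⟩ := Finset.mem_sigma.1 hu
      have hi : i < q := Finset.mem_range.1 hi
      change t ∈ tasks F r S C d i at ht
      change root i ⊆ B at hB
      obtain ⟨ht, hdiag, hdiv, hcard⟩ := Finset.mem_filter.1 ht
      obtain ⟨ht1, ht2⟩ := Finset.mem_product.1 ht
      obtain ⟨ht2, ht3⟩ := Finset.mem_product.1 ht2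
      rw [Finset.mem_powerset] at ht1
      rw [Finset.mem_range] at ht2 ht3
      -- The carriers and the absorbers chosen so far are deleted from `G` beforehand, so an
      -- absorber found in the rest is edge-disjoint from them.
      have hcn : HasCommonNeighbors (G.deleteEdges {e | e ∈ E₀ + E}) (3 * r) b :=
        hasCommonNeighbors_deleteEdges hG (fun v => by
          rw [Multiset.countP_add]; exact Nat.add_le_add (hCd v) (hE v)) hn
      have hsub1 : Finset.range t.2.1 ⊆ Finset.range d :=
        Finset.range_subset_range.2 (by omega)
      have hsub2 : Finset.Ico t.2.2 d ⊆ Finset.range d := fun l hl =>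
        Finset.mem_range.2 (Finset.mem_Ico.1 hl).2
      have hmem : ∀ e ∈ exchange C d i t, e ∈ t.1 ∨ ∃ i' l, (i' = i ∨ i' = i + 1) ∧ l < d ∧
          e ∈ C i' l := by
        intro e he
        rcases Multiset.mem_add.1 he with he | he
        · rcases Multiset.mem_add.1 he with he | he
          · exact Or.inl he
          · obtain ⟨l, hl, he⟩ := Multiset.mem_sum.1 he
            exact Or.inr ⟨i, l, Or.inl rfl, Finset.mem_range.1 (hsub1 hl), he⟩
        · obtain ⟨l, hl, he⟩ := Multiset.mem_sum.1 he
          exact Or.inr ⟨i + 1, l, Or.inr rfl, Finset.mem_range.1 (hsub2 hl), he⟩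
      obtain ⟨κ, hκ⟩ := hcard
      have hcardle : Multiset.card (exchange C d i t) ≤ m * m + 2 * (d * cC) := by
        have h1 : t.1.card ≤ m * m := (Finset.card_le_card ht1).trans (card_edges_le (hS i))
        have h2 : ∀ i' ≤ q, ∀ s ⊆ Finset.range d, Multiset.card (∑ l ∈ s, C i' l) ≤ d * cC := by
          intro i' hi' s hs
          rw [Multiset.card_sum, Finset.sum_congr rfl fun l hl =>
            hCc i' hi' l (Finset.mem_range.1 (hs hl)), Finset.sum_const, smul_eq_mul]
          exact Nat.mul_le_mul_right _ ((Finset.card_le_card hs).trans (by simp))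
        have h3 := h2 i hi.le _ hsub1
        have h4 := h2 (i + 1) hi _ hsub2
        rw [exchange, Multiset.card_add, Multiset.card_add, Finset.card_val]
        omega
      have hDpos : 0 < F.edgeFinset.card :=
        Finset.card_pos.2 ⟨s(x, n₀), SimpleGraph.mem_edgeFinset.2 n₀.2⟩
      have hκle : κ ≤ m * m + 2 * (d * cC) := by
        refine le_trans ?_ hcardle
        rw [hκ]
        exact Nat.le_mul_of_pos_left _ hDpos
      have habs := convertible_absorber (R := root i) hF hr hcn n₀ (X := exchange C d i t)
        (k := κ) (by rw [hκ, mul_comm])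
        (by
          intro e he
          rcases hmem e he with he | ⟨i', l, hi', hl, he⟩
          · exact hdiag e he
          · exact G.not_isDiag_of_mem_edgeSet (hCG i' (by omega) l hl e he))
        (by
          intro e he v hv
          rcases hmem e he with he | ⟨i', l, hi', hl, he⟩
          · obtain ⟨w, hw, rfl⟩ := Finset.mem_image.1 (ht1 he)
            obtain ⟨hw1, hw2⟩ := Finset.mem_product.1 hw
            rcases Sym2.mem_iff.1 hv with rfl | rfl
            exacts [Finset.mem_union_left _ hw1, Finset.mem_union_left _ hw2]
          · have hv' : v ∈ supp (CC i') :=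
              mem_supp (Multiset.mem_sum.2 ⟨l, Finset.mem_range.2 hl, he⟩) hv
            rcases hi' with rfl | rfl
            · exact Finset.mem_union_right _ (Finset.mem_union_left _ hv')
            · exact Finset.mem_union_right _ (Finset.mem_union_right _ hv'))
        hdiv
      obtain ⟨N, T, hN, hNk, hF', hT₁, hT₂⟩ := habs.mono (k₂ := k) subset_rfl
        ((absorberCost_mono le_rfl hκle).trans hk) B hB hBk
      have hnot : ∀ e ∈ T, e ∈ G.edgeSet ∧ e ∉ E₀ + E := by
        intro e he
        have := hF'.mem_edgeSet e he
        rw [SimpleGraph.edgeSet_deleteEdges] at this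
        exact this
      refine ⟨N, T, hN, hNk, ⟨hF'.nodup, fun e he => (hnot e he).1, hF'.exists_new, hF'.subset⟩,
        fun e he h => (hnot e he).2 (Multiset.mem_add.2 (Or.inr h)), by simpa using hT₂, hT₁,
        fun e he h => (hnot e he).2 (Multiset.mem_add.2 (Or.inl h))⟩)
  exact ⟨T, fun i hi t ht => hT ⟨i, t⟩ (Finset.mem_sigma.2 ⟨Finset.mem_range.2 hi, ht⟩),
    hT₁, hT₂, hT₃⟩

/-- Simultaneous choice of edge-disjoint carriers. -/
theorem exists_carriers (hF : F.IsRegularOfDegree r) {x y : W} (hxy : F.Adj x y) {g : ℕ}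
    (hg : r ∣ 2 * g) (hgr : g ≤ r) {q d a b β k : ℕ} (hk : 1 + g * Fintype.card W ≤ k)
    (hG : ∀ v, Fintype.card V ≤ G.degree v + a)
    (hn : 3 * r * (a + (1 + k)) + b ≤ Fintype.card V)
    (hβ : 2 * ((q + 1) * d * k ^ 2) ≤ β) (hb : β + k ≤ b) :
    ∃ C : ℕ → ℕ → Multiset (Sym2 V),
      (∀ i ≤ q, ∀ l < d, (∀ v, r ∣ (C i l).countP fun e => v ∈ e) ∧
        Multiset.card (C i l) = g * (1 + F.edgeFinset.card)) ∧
      (∑ i ∈ Finset.range (q + 1), ∑ l ∈ Finset.range d, C i l).Nodup ∧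
      (∀ e ∈ ∑ i ∈ Finset.range (q + 1), ∑ l ∈ Finset.range d, C i l, e ∈ G.edgeSet) ∧
      ∀ v, (∑ i ∈ Finset.range (q + 1), ∑ l ∈ Finset.range d, C i l).countP (fun e => v ∈ e) ≤
        1 + k := by
  -- Carriers have no roots, and `θ := 1` bars every vertex already used. The resulting degree bound
  -- does not involve `n`, which matters because the carriers become roots of absorbers.
  obtain ⟨T, hT, hT₁, hT₂, hT₃⟩ := exists_edgeDisjoint_family (G := G)
    (Finset.range (q + 1) ×ˢ Finset.range d) (fun _ => ∅)
    (fun _ T => (∀ v, r ∣ T.countP fun e => v ∈ e) ∧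
      Multiset.card T = g * (1 + F.edgeFinset.card)) (k := k) (ρ₀ := 0) (K := k) (b := b)
    (θ := 1) (β := β) (ρ := 0) (zero_add _) one_pos (by simp) (by simp)
    (by simpa using hβ) hb (by
      intro _ _ E hE B _ hB
      have hcn : HasCommonNeighbors (G.deleteEdges {e | e ∈ E}) (3 * r) b :=
        hasCommonNeighbors_deleteEdges hG (fun v => by simpa using hE v) hn
      obtain ⟨N, T, hN, hNk, hF', hT⟩ := exists_fresh_carrier hF hcn hxy hg hgr B (by omega)
      have hnot : ∀ e ∈ T, e ∈ G.edgeSet ∧ e ∉ E := by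
        intro e he
        have := hF'.mem_edgeSet e he
        rw [SimpleGraph.edgeSet_deleteEdges] at this
        exact this
      exact ⟨N, T, hN, hNk.trans hk, ⟨hF'.nodup, fun e he => (hnot e he).1, hF'.exists_new,
        hF'.subset⟩, fun e he => (hnot e he).2, hT⟩)
  refine ⟨fun i l => T (i, l), fun i hi l hl => hT (i, l) (Finset.mem_product.2
    ⟨Finset.mem_range.2 (by omega), Finset.mem_range.2 hl⟩), ?_⟩
  rw [← Finset.sum_product' (f := fun i l => T (i, l))]
  exact ⟨hT₁, hT₂, fun v => by simpa using hT₃ v⟩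

end Tasks

/-! ### Balancing the parts and assembling the absorbing graph -/

section Assembly

variable {W V : Type*} [Fintype W] [Fintype V] {F : SimpleGraph W} {G : SimpleGraph V} {r : ℕ}

/-- Given absorbers for all tasks, the carriers balance the numbers of edges in the parts. -/
theorem add_mem_decomposable (hF : F.IsRegularOfDegree r) {c : V → ℕ} {q d g : ℕ}
    (hc : ∀ v, c v < q) (hg : 0 < g) (hd : 0 < d) (hgd : F.edgeFinset.card = g * d)
    (hgr : ∀ h, r ∣ 2 * h → g ∣ h) {C : ℕ → ℕ → Multiset (Sym2 V)}
    (hC : ∀ i ≤ q, ∀ l < d, (∀ v, r ∣ (C i l).countP fun e => v ∈ e) ∧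
      Multiset.card (C i l) = g * (1 + F.edgeFinset.card))
    {T : (Σ _ : ℕ, Finset (Sym2 V) × ℕ × ℕ) → Multiset (Sym2 V)}
    (hT : ∀ i < q, ∀ t ∈ tasks F r (fun i => Finset.univ.filter fun v => c v = i) C d i,
      T ⟨i, t⟩ ∈ decomposable F V ∧ T ⟨i, t⟩ + exchange C d i t ∈ decomposable F V)
    {H : SimpleGraph V} (hH : IsDivisible F H) (hHc : ∀ u v, H.Adj u v → c u = c v) :
    (∑ i ∈ Finset.range q, ∑ l ∈ Finset.range d, C (i + 1) l) +
      (∑ u ∈ (Finset.range q).sigma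
        (tasks F r (fun i => Finset.univ.filter fun v => c v = i) C d), T u) +
      H.edgeFinset.val ∈ decomposable F V := by
  set S : ℕ → Finset V := fun i => Finset.univ.filter fun v => c v = i with hS
  have hmono : ∀ e ∈ H.edgeFinset, ∀ u ∈ e, ∀ v ∈ e, c u = c v := by
    intro e he u hu v hv
    rw [SimpleGraph.mem_edgeFinset] at he
    induction e with
    | _ a b =>
      have hab := hHc a b he
      rcases Sym2.mem_iff.1 hu with rfl | rfl <;> rcases Sym2.mem_iff.1 hv with rfl | rfl
      exacts [rfl, hab, hab.symm, rfl]
  let Hi : ℕ → Finset (Sym2 V) := fun i => H.edgeFinset.filter fun e => ∀ v ∈ e, c v = i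
  have hHi : H.edgeFinset.val = ∑ i ∈ Finset.range q, (Hi i).val := by
    refine (Multiset.Nodup.ext (Finset.nodup _) (nodup_sum (fun i _ => Finset.nodup _) ?_)).2 ?_
    · intro i _ j _ e he he'
      have h1 := (Finset.mem_filter.1 (Finset.mem_val.mp he)).2
      have h2 := (Finset.mem_filter.1 (Finset.mem_val.mp he')).2
      induction e with
      | _ a b => exact (h1 a (by simp)).symm.trans (h2 a (by simp))
    · intro e
      rw [Multiset.mem_sum]
      constructor
      · intro he
        have h : ∃ v, v ∈ e := by
          induction e with
          | _ a b => exact ⟨a, by simp⟩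
        obtain ⟨v, hv⟩ := h
        exact ⟨c v, Finset.mem_range.2 (hc v), Finset.mem_filter.2
          ⟨he, fun u hu => hmono e he u hu v hv⟩⟩
      · rintro ⟨i, -, he⟩
        exact (Finset.mem_filter.1 (Finset.mem_val.mp he)).1
  have hHidiv : ∀ i v, r ∣ (Hi i).val.countP fun e => v ∈ e := by
    intro i v
    rw [Finset.filter_val, Multiset.countP_filter]
    by_cases hv : c v = i
    · rw [Multiset.countP_congr rfl (p' := fun e => v ∈ e), countP_mem_edgeFinset]
      · exact hH.dvd_degree hF v
      · intro e he
        simp only [eq_iff_iff, and_iff_left_iff_imp]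
        exact fun hve u hu => (hmono e he u hu v hve).trans hv
    · rw [Multiset.countP_eq_zero.2]
      · exact dvd_zero _
      · exact fun e _ h => hv (h.2 v h.1)
  have hHidiag : ∀ i, ∀ e ∈ Hi i, ¬ e.IsDiag := fun i e he =>
    H.not_isDiag_of_mem_edgeSet (SimpleGraph.mem_edgeFinset.1 (Finset.mem_filter.1 he).1)
  have hHig : ∀ i, g ∣ (Hi i).card := by
    intro i
    refine hgr _ ?_
    rw [← Finset.card_val, ← sum_countP_mem (T := (Hi i).val) (hHidiag i)]
    exact Finset.dvd_sum fun v _ => hHidiv i v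
  choose n hn using hHig
  -- The surplus of the parts before part `i`, in units of `g` and modulo `d`. It is the number of
  -- carriers `C i l` that part `i` takes; the remaining ones fall to part `i - 1`.
  let j : ℕ → ℕ := fun i => (∑ i' ∈ Finset.range i, n i') % d
  have hjlt : ∀ i, j i < d := fun i => Nat.mod_lt _ hd
  have hj0 : j 0 = 0 := by simp [j]
  -- The total number of edges of `H` is divisible by `e(F) = g * d`, so no surplus remains after
  -- the last part.
  have hjq : j q = 0 := by
    refine Nat.mod_eq_zero_of_dvd ?_
    have h1 : F.edgeFinset.card ∣ H.edgeFinset.card := hH.1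
    rw [← Finset.card_val H.edgeFinset, hHi, Multiset.card_sum, hgd] at h1
    simp only [Finset.card_val, hn] at h1
    rw [← Finset.mul_sum] at h1
    exact Nat.dvd_of_mul_dvd_mul_left hg h1
  have hjs : ∀ i, d ∣ n i + (j i + (d - j (i + 1))) := by
    intro i
    have h1 : j (i + 1) = (j i + n i) % d := by
      simp only [j, Finset.sum_range_succ, Nat.mod_add_mod]
    have h2 := Nat.mod_add_div (j i + n i) d
    have h3 := hjlt (i + 1)
    -- The extra `1` accounts for the `d` in `d - j (i + 1)`.
    refine ⟨(j i + n i) / d + 1, ?_⟩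
    rw [mul_add, mul_one]
    omega
  let t : ℕ → Finset (Sym2 V) × ℕ × ℕ := fun i => (Hi i, j i, j (i + 1))
  have hlow : ∀ i, ∀ l ∈ Finset.range (j i), l < d := fun i l hl =>
    (Finset.mem_range.1 hl).trans (hjlt i)
  have hhigh : ∀ i, ∀ l ∈ Finset.Ico (j i) d, l < d := fun i l hl => (Finset.mem_Ico.1 hl).2
  have ht : ∀ i < q, t i ∈ tasks F r S C d i := by
    intro i hi
    refine Finset.mem_filter.2 ⟨Finset.mem_product.2 ⟨Finset.mem_powerset.2 ?_,
      Finset.mem_product.2 ⟨Finset.mem_range.2 ((hjlt i).trans (Nat.lt_succ_self d)),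
        Finset.mem_range.2 ((hjlt (i + 1)).trans (Nat.lt_succ_self d))⟩⟩, hHidiag i, ?_, ?_⟩
    · intro e he
      have he := (Finset.mem_filter.1 he).2
      induction e with
      | _ a b =>
        exact Finset.mem_image.2 ⟨(a, b), Finset.mem_product.2
          ⟨Finset.mem_filter.2 ⟨Finset.mem_univ _, he a (by simp)⟩,
            Finset.mem_filter.2 ⟨Finset.mem_univ _, he b (by simp)⟩⟩, rfl⟩
    · intro v
      rw [exchange, Multiset.countP_add, Multiset.countP_add, countP_sum, countP_sum]
      exact dvd_add (dvd_add (hHidiv i v) (Finset.dvd_sum fun l hl =>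
        (hC i hi.le l (hlow _ l hl)).1 v)) (Finset.dvd_sum fun l hl =>
        (hC (i + 1) hi l (hhigh _ l hl)).1 v)
    · rw [exchange, Multiset.card_add, Multiset.card_add, Multiset.card_sum, Multiset.card_sum,
        Finset.sum_congr rfl fun l hl => (hC i hi.le l (hlow _ l hl)).2,
        Finset.sum_congr rfl fun l hl => (hC (i + 1) hi l (hhigh _ l hl)).2]
      simp only [Finset.card_val, Finset.sum_const, Finset.card_range, Nat.card_Ico, smul_eq_mul,
        t, hn]
      -- Modulo `e(F)` each carrier counts for `g` edges.
      have h1 : g * n i + j i * (g * (1 + F.edgeFinset.card)) +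
          (d - j (i + 1)) * (g * (1 + F.edgeFinset.card)) =
          g * (n i + (j i + (d - j (i + 1)))) +
            F.edgeFinset.card * (g * (j i + (d - j (i + 1)))) := by ring
      rw [h1]
      refine dvd_add ?_ (dvd_mul_right _ _)
      rw [hgd]
      exact mul_dvd_mul_left _ (hjs i)
  -- The last `d - j (i + 1)` carriers of the bundle `C (i + 1)` go to part `i` and the others to
  -- part `i + 1`. As `j 0 = j q = 0`, no carrier of `C 0` is used and all of `C q` go to part `q -
  -- 1`.
  have hcarry : (∑ i ∈ Finset.range q, ∑ l ∈ Finset.range d, C (i + 1) l) + H.edgeFinset.val =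
      ∑ i ∈ Finset.range q, exchange C d i (t i) := by
    have h1 : ∑ i ∈ Finset.range q, ∑ l ∈ Finset.range (j i), C i l =
        ∑ i ∈ Finset.range q, ∑ l ∈ Finset.range (j (i + 1)), C (i + 1) l := by
      have h2 := Finset.sum_range_succ (fun i => ∑ l ∈ Finset.range (j i), C i l) q
      have h3 := Finset.sum_range_succ' (fun i => ∑ l ∈ Finset.range (j i), C i l) q
      simp only [hj0, hjq, Finset.range_zero, Finset.sum_empty, add_zero] at h2 h3
      rw [← h2, h3]
    have h4 : ∀ i, ∑ l ∈ Finset.range d, C (i + 1) l =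
        ∑ l ∈ Finset.range (j (i + 1)), C (i + 1) l + ∑ l ∈ Finset.Ico (j (i + 1)) d, C (i + 1) l :=
      fun i => (Finset.sum_range_add_sum_Ico _ (hjlt (i + 1)).le).symm
    simp only [exchange, t, Finset.sum_add_distrib, h1, h4]
    rw [hHi]
    abel
  -- The absorbers of these tasks swallow their exchanges; all the others are decomposed by
  -- themselves.
  let used : Finset (Σ _ : ℕ, Finset (Sym2 V) × ℕ × ℕ) :=
    (Finset.range q).image fun i => ⟨i, t i⟩
  have hused : used ⊆ (Finset.range q).sigma (tasks F r S C d) := by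
    intro u hu
    obtain ⟨i, hi, rfl⟩ := Finset.mem_image.1 hu
    exact Finset.mem_sigma.2 ⟨hi, ht i (Finset.mem_range.1 hi)⟩
  have husum : ∑ u ∈ used, T u = ∑ i ∈ Finset.range q, T ⟨i, t i⟩ :=
    Finset.sum_image fun i _ i' _ h => congrArg Sigma.fst h
  rw [← Finset.sum_sdiff hused, husum, add_right_comm, hcarry, add_comm, add_assoc,
    ← Finset.sum_add_distrib]
  refine add_mem (sum_mem fun u hu => ?_) (sum_mem fun i hi => ?_)
  · obtain ⟨hu1, hu2⟩ := Finset.mem_sigma.1 (Finset.mem_sdiff.1 hu).1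
    exact (hT u.1 (Finset.mem_range.1 hu1) u.2 hu2).1
  · exact (hT i (Finset.mem_range.1 hi) (t i) (ht i (Finset.mem_range.1 hi))).2

/-- The absorbing graph, with explicit conditions on the parameters. -/
theorem exists_absorbing_graph (hF : F.IsRegularOfDegree r) (hr : 0 < r) [Nonempty W] {c : V → ℕ}
    {q m L k₁ k ρ₀ K M ρ θ β₁ β a b : ℕ} (hc : ∀ v, c v < q)
    (hm : ∀ i, (Finset.univ.filter fun v => c v = i).card ≤ m)
    (hGc : ∀ u v, G.Adj u v → c u ≠ c v) (hL : r * Fintype.card W = L) (hk₁ : 1 + L = k₁)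
    (hρ₀ : m + 4 * (L * (r * (1 + L))) = ρ₀)
    (hk : absorberCost r (Fintype.card W) L (m * m + 2 * (L * (r * (1 + L)))) = k)
    (hK : ρ₀ + k = K) (hM : 2 ^ (m * m) * ((L + 1) * (L + 1)) = M)
    (hρ : (1 + 2 * (1 + k₁)) * M = ρ) (hG : ∀ v, Fintype.card V ≤ G.degree v + a)
    (hn : 3 * r * (a + (1 + k₁ + (θ + K + K * ρ))) + b ≤ Fintype.card V)
    (hβ₁ : 2 * ((q + 1) * L * k₁ ^ 2) ≤ β₁) (hb₁ : β₁ + k₁ ≤ b)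
    (hβ : 2 * (q * M * K ^ 2) ≤ β * θ) (hb : β + K ≤ b) (hθ : 0 < θ) :
    ∃ A ≤ G, IsDivisible F A ∧ (∀ v, A.degree v ≤ 1 + k₁ + (θ + K + K * ρ)) ∧
      ∀ H : SimpleGraph V, IsDivisible F H → (∀ u v, H.Adj u v → c u = c v) →
        HasDecomposition F (A ⊔ H) := by
  obtain ⟨x⟩ := ‹Nonempty W›
  have : Nonempty W := ⟨x⟩
  obtain ⟨n₀⟩ : Nonempty (F.neighborSet x) :=
    Fintype.card_pos_iff.1 (by rw [card_neighborSet hF]; exact hr)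
  obtain ⟨g, hg0, hgr, hrg, hdvd⟩ := exists_unit_dvd hr
  have hhand : 2 * F.edgeFinset.card = L := by
    rw [← F.sum_degrees_eq_twice_card_edges, Finset.sum_congr rfl fun w _ => hF.degree_eq w,
      Finset.sum_const, Finset.card_univ, smul_eq_mul, mul_comm, hL]
  have hDpos : 0 < F.edgeFinset.card :=
    Finset.card_pos.2 ⟨s(x, n₀), SimpleGraph.mem_edgeFinset.2 n₀.2⟩
  obtain ⟨d, hgd⟩ : g ∣ F.edgeFinset.card :=
    hdvd _ (by rw [hhand, ← hL]; exact dvd_mul_right _ _)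
  have hd0 : 0 < d := Nat.pos_of_ne_zero fun h => by rw [hgd, h] at hDpos; simp at hDpos
  have hDL : F.edgeFinset.card ≤ L := by omega
  have hdL : d ≤ L := le_trans (by rw [hgd]; exact Nat.le_mul_of_pos_left _ hg0) hDL
  have hcL : g * (1 + F.edgeFinset.card) ≤ r * (1 + L) :=
    Nat.mul_le_mul hgr (Nat.add_le_add_left hDL _)
  have hdcL : d * (g * (1 + F.edgeFinset.card)) ≤ L * (r * (1 + L)) := Nat.mul_le_mul hdL hcL
  obtain ⟨C, hC, hC₁, hC₂, hC₃⟩ := exists_carriers (q := q) (d := d) (β := β₁) (k := k₁) hF n₀.2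
    hrg hgr (by rw [← hk₁, ← hL]; exact Nat.add_le_add_left (Nat.mul_le_mul_right _ hgr) _) hG
    (le_trans (Nat.add_le_add_right (Nat.mul_le_mul_left _ (by omega)) _) hn)
    (le_trans (Nat.mul_le_mul_left _ (Nat.mul_le_mul_right _ (Nat.mul_le_mul_left _ hdL))) hβ₁)
    hb₁
  have hCG : ∀ i ≤ q, ∀ l < d, ∀ e ∈ C i l, e ∈ G.edgeSet := fun i hi l hl e he =>
    hC₂ e (Multiset.mem_sum.2 ⟨i, Finset.mem_range.2 (by omega), Multiset.mem_sum.2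
      ⟨l, Finset.mem_range.2 hl, he⟩⟩)
  obtain ⟨T, hT, hT₁, hT₂, hT₃⟩ := exists_absorbers
    (S := fun i => Finset.univ.filter fun v => c v = i) (C := C) (q := q) (d := d) (θ := θ) (β := β) (ρ := ρ) hF hr n₀ hm
    (fun i j v hi hj => (Finset.mem_filter.1 hi).2.symm.trans (Finset.mem_filter.1 hj).2)
    (fun i hi l hl => (hC i hi l hl).2) hCG hC₃
    (le_trans (Nat.add_le_add_left (Nat.mul_le_mul_left _ hdcL) _) hρ₀.le)
    ((absorberCost_mono hDL
      (Nat.add_le_add_left (Nat.mul_le_mul_left _ hdcL) _)).trans hk.le) hK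
    (le_trans (Nat.mul_le_mul_left _ (Nat.mul_le_mul (by omega) (by omega))) hM.le) hρ.le hG hn hβ
    hb hθ
  -- The bundle `C 0` is left out of `A`, since part `0` takes none of it.
  set E₁ := ∑ i ∈ Finset.range q, ∑ l ∈ Finset.range d, C (i + 1) l with hE₁
  set E₂ := ∑ u ∈ (Finset.range q).sigma
    (tasks F r (fun i => Finset.univ.filter fun v => c v = i) C d), T u with hE₂
  have hsplit : ∑ i ∈ Finset.range (q + 1), ∑ l ∈ Finset.range d, C i l =
      E₁ + ∑ l ∈ Finset.range d, C 0 l := Finset.sum_range_succ' _ _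
  have hE₁mem : ∀ e ∈ E₁, e ∈ ∑ i ∈ Finset.range (q + 1), ∑ l ∈ Finset.range d, C i l :=
    fun e he => by rw [hsplit]; exact Multiset.mem_add.2 (Or.inl he)
  have hE₂not : ∀ e ∈ E₂, e ∉ ∑ i ∈ Finset.range (q + 1), ∑ l ∈ Finset.range d, C i l := by
    intro e he
    obtain ⟨u, hu, he⟩ := Multiset.mem_sum.1 he
    obtain ⟨hu1, hu2⟩ := Finset.mem_sigma.1 hu
    exact (hT u.1 (Finset.mem_range.1 hu1) u.2 hu2).2.2 e he
  have hnodup : (E₁ + E₂).Nodup := by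
    refine Multiset.nodup_add.2 ⟨?_, hT₁, Multiset.disjoint_left.2 fun {e} he he' =>
      hE₂not e he' (hE₁mem e he)⟩
    rw [hsplit] at hC₁
    exact (Multiset.nodup_add.1 hC₁).1
  have hEG : ∀ e ∈ E₁ + E₂, e ∈ G.edgeSet := by
    intro e he
    rcases Multiset.mem_add.1 he with he | he
    exacts [hC₂ e (hE₁mem e he), hT₂ e he]
  obtain ⟨A, hA⟩ : ∃ A : SimpleGraph V, A = SimpleGraph.fromEdgeSet {e | e ∈ E₁ + E₂} :=
    ⟨_, rfl⟩
  have hAedge : A.edgeFinset.val = E₁ + E₂ := by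
    refine (Multiset.Nodup.ext (Finset.nodup _) hnodup).2 fun e => ?_
    rw [Finset.mem_val, SimpleGraph.mem_edgeFinset, hA, SimpleGraph.edgeSet_fromEdgeSet]
    exact ⟨fun h => h.1, fun h => ⟨h, G.not_isDiag_of_mem_edgeSet (hEG e h)⟩⟩
  have hAG : A ≤ G := by
    intro u v h
    rw [hA] at h
    exact hEG _ ((SimpleGraph.fromEdgeSet_adj _).1 h).1
  have hmem : ∀ H : SimpleGraph V, IsDivisible F H → (∀ u v, H.Adj u v → c u = c v) →
      A.edgeFinset.val + H.edgeFinset.val ∈ decomposable F V := fun H hH hHc => by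
    rw [hAedge]
    exact add_mem_decomposable hF hc hg0 hd0 hgd hdvd hC
      (fun i hi t ht => ⟨(hT i hi t ht).1, (hT i hi t ht).2.1⟩) hH hHc
  refine ⟨A, hAG, ?_, ?_, ?_⟩
  · refine isDivisible_of_mem_decomposable hF ?_
    -- Absorbing the empty graph shows that `A` itself decomposes, hence is `F`-divisible.
    obtain ⟨Z, hZ⟩ : ∃ Z : SimpleGraph V, Z = ⊥ := ⟨_, rfl⟩
    have hbot : Z.edgeFinset.val = 0 :=
      Multiset.eq_zero_of_forall_notMem fun e he => by
        rw [Finset.mem_val, SimpleGraph.mem_edgeFinset, hZ, SimpleGraph.edgeSet_bot] at he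
        exact he
    have h := hmem Z (isDivisible_of_mem_decomposable hF (by rw [hbot]; exact zero_mem _))
      (fun u v h => by rw [hZ] at h; exact h.elim)
    rwa [hbot, add_zero] at h
  · intro v
    rw [← countP_mem_edgeFinset, hAedge, Multiset.countP_add]
    refine Nat.add_le_add (le_trans ?_ (hC₃ v)) (hT₃ v)
    rw [hsplit, Multiset.countP_add]
    exact Nat.le_add_right _ _
  · intro H hH hHc
    refine hasDecomposition_of_mem_decomposable ?_
    have hdisj : Disjoint A.edgeFinset.val H.edgeFinset.val := by
      rw [Multiset.disjoint_left]
      intro e he he'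
      rw [Finset.mem_val, SimpleGraph.mem_edgeFinset] at he he'
      induction e with
      | _ u v => exact hGc u v (hAG he) (hHc u v he')
    obtain ⟨K', hK'⟩ : ∃ K', K' = A ⊔ H := ⟨_, rfl⟩
    rw [← hK']
    convert hmem H hH hHc using 1
    refine (Multiset.Nodup.ext (Finset.nodup _)
      (Multiset.nodup_add.2 ⟨Finset.nodup _, Finset.nodup _, hdisj⟩)).2 fun e => ?_
    rw [Multiset.mem_add, Finset.mem_val, Finset.mem_val, Finset.mem_val,
      SimpleGraph.mem_edgeFinset, SimpleGraph.mem_edgeFinset, SimpleGraph.mem_edgeFinset, hK',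
      SimpleGraph.edgeSet_sup, Set.mem_union]

end Assembly

/-! ### Choice of the parameters -/

section Parameters

/-- The number of graphs that may have to be absorbed at a part, in terms of the size of the part
and the degree sum of `F`. -/
def taskBound (m L : ℕ) : ℕ := 2 ^ (m * m) * ((L + 1) * (L + 1))

/-- The number of vertices of an absorber for a part. -/
def gadgetBound (r f m : ℕ) : ℕ :=
  m + 4 * (r * f * (r * (1 + r * f))) +
    absorberCost r f (r * f) (m * m + 2 * (r * f * (r * (1 + r * f))))

/-- The number of absorbers in which a vertex may be a root. -/
def rootBound (m L : ℕ) : ℕ := (1 + 2 * (1 + (1 + L))) * taskBound m L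

/-- The numbers of vertices that are large enough for the construction. -/
def sizeBound (r f t m : ℕ) : ℕ :=
  16 * t ^ 2 * (1 + (1 + r * f) + gadgetBound r f m + gadgetBound r f m * rootBound m (r * f) +
    32 * t ^ 2 * taskBound m (r * f) * gadgetBound r f m ^ 2 + m + 1)

/-- The slack in the minimum degree contributes `3 * r * x`. The loss `d` costs at most half of it,
and the other half covers `b`. -/
theorem three_mul_add_le {r n a d x b : ℝ} (hr : 1 ≤ r) (hx : 0 ≤ x) (ha : a ≤ n / (3 * r) - x)
    (hd : d ≤ x / 2) (hb : b ≤ x) : 3 * r * (a + d) + b ≤ n := by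
  have h₁ : a + d ≤ n / (3 * r) - x / 2 := by linarith
  have h₂ := mul_le_mul_of_nonneg_left h₁ (show (0 : ℝ) ≤ 3 * r by linarith)
  have h₃ : 3 * r * (n / (3 * r) - x / 2) = n - 3 / 2 * (r * x) := by field_simp
  have h₄ : x ≤ r * x := le_mul_of_one_le_left hx hr
  linarith

/-- Here `1 / t` stands for `ε`. Absorbers use `θ` about `n / (4 * t ^ 2)`: small enough for the
degree bound, yet linear in `n`, so that the number `β` of barred vertices stays bounded although `q
* M` is linear in `n`. The vertex-disjoint carriers bar up to about `6 * (n / m) * L * k₁ ^ 2`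
vertices, and `m ≥ 12 * t * L * k₁ ^ 2` makes this at most half of `n / t`, the approximate size of
`b`. -/
theorem exists_parameters {r L t k₁ K M ρ m n q a : ℕ} (hr : 1 ≤ r) (ht : 1 ≤ t) (hm : 1 ≤ m)
    (hmL : 12 * t * (L * k₁ ^ 2) ≤ m)
    (hn : 16 * t ^ 2 * (1 + k₁ + K + K * ρ + 32 * t ^ 2 * M * K ^ 2 + m + 1) ≤ n)
    (hq : (q : ℝ) ≤ n / m + 1) (ha : (a : ℝ) ≤ n / (3 * r) - n / t) :
    ∃ θ β₁ β b : ℕ, 3 * r * (a + (1 + k₁ + (θ + K + K * ρ))) + b ≤ n ∧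
      2 * ((q + 1) * L * k₁ ^ 2) ≤ β₁ ∧ β₁ + k₁ ≤ b ∧ 2 * (q * M * K ^ 2) ≤ β * θ ∧ β + K ≤ b ∧
      0 < θ ∧ ((1 + k₁ + (θ + K + K * ρ) : ℕ) : ℝ) ≤ (1 / (t : ℝ)) ^ 2 * n := by
  have hr' : (1 : ℝ) ≤ r := by exact_mod_cast hr
  have ht' : (1 : ℝ) ≤ t := by exact_mod_cast ht
  have hm' : (1 : ℝ) ≤ m := by exact_mod_cast hm
  have hn' : 16 * (t : ℝ) ^ 2 * (1 + k₁ + K + K * ρ + 32 * t ^ 2 * M * K ^ 2 + m + 1) ≤ n := by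
    exact_mod_cast hn
  have hmL' : 12 * (t : ℝ) * (L * k₁ ^ 2) ≤ m := by exact_mod_cast hmL
  obtain ⟨θ, hθ⟩ : ∃ θ, θ = n / (4 * t ^ 2) := ⟨_, rfl⟩
  obtain ⟨b, hb⟩ : ∃ b, b = n / t := ⟨_, rfl⟩
  obtain ⟨β, hβ⟩ : ∃ β, β = 32 * t ^ 2 * M * K ^ 2 := ⟨_, rfl⟩
  have hβ' : (β : ℝ) = 32 * t ^ 2 * M * K ^ 2 := by rw [hβ]; push_cast; ring
  -- The unit in which all quantities linear in `n` are compared.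
  obtain ⟨z, hz⟩ : ∃ z : ℝ, z = n / t ^ 2 := ⟨_, rfl⟩
  have hnz : (n : ℝ) = z * t ^ 2 := by rw [hz]; field_simp
  have hnt : (n : ℝ) / t = z * t := by rw [hz]; field_simp
  have hz16 : 16 * (1 + k₁ + K + K * ρ + β + m + 1) ≤ z := by
    rw [hz, le_div_iff₀ (by positivity), hβ']
    linarith
  have hpos : 0 ≤ (k₁ : ℝ) ∧ 0 ≤ (K : ℝ) ∧ 0 ≤ (K * ρ : ℝ) ∧ 0 ≤ (β : ℝ) :=
    ⟨by positivity, by positivity, by positivity, by positivity⟩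
  obtain ⟨p1, p2, p3, p4⟩ := hpos
  have hz0 : 0 ≤ z := by linarith
  have hzt : z ≤ z * t := le_mul_of_one_le_right hz0 ht'
  have hztt : z * t ≤ z * t ^ 2 := by
    rw [pow_two, ← mul_assoc]
    exact le_mul_of_one_le_right (by positivity) ht'
  have hθle : (θ : ℝ) ≤ z / 4 := by
    refine (hθ ▸ Nat.cast_div_le : (θ : ℝ) ≤ (n : ℝ) / (4 * t ^ 2 : ℕ)).trans (le_of_eq ?_)
    rw [hnz]; push_cast; field_simp
  have hθge : z / 8 ≤ θ := by
    have h1 : (n : ℝ) < (θ + 1) * (4 * t ^ 2) := by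
      have := Nat.lt_mul_div_succ n (show 0 < 4 * t ^ 2 by positivity)
      rw [← hθ] at this
      have h2 : (n : ℝ) < ((4 * t ^ 2 * (θ + 1) : ℕ) : ℝ) := by exact_mod_cast this
      push_cast at h2
      linarith
    have h2 : z < 4 * (θ + 1) := by
      rw [hnz] at h1
      have h3 : 0 < (t : ℝ) ^ 2 := by positivity
      refine lt_of_mul_lt_mul_right (h1.trans_eq ?_) h3.le
      ring
    linarith
  have hble : (b : ℝ) ≤ z * t := by rw [← hnt, hb]; exact Nat.cast_div_le
  have hbge : z * t - 1 ≤ b := by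
    have := Nat.lt_mul_div_succ n (show 0 < t by omega)
    rw [← hb] at this
    have h2 : (n : ℝ) < ((t * (b + 1) : ℕ) : ℝ) := by exact_mod_cast this
    push_cast at h2
    have h3 : (n : ℝ) / t < b + 1 := by
      rw [div_lt_iff₀ (by linarith)]; linarith
    linarith
  have hd : (1 + k₁ + (θ + K + K * ρ) : ℝ) ≤ z / 2 := by linarith
  have hnm : (m : ℝ) ≤ n := by
    rw [hnz]; linarith
  have hk₁b : (k₁ : ℝ) ≤ b := by linarith
  have hk₁b' : k₁ ≤ b := by exact_mod_cast hk₁b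
  refine ⟨θ, b - k₁, β, b, ?_, ?_, by omega, ?_, ?_, ?_, ?_⟩
  · have h1 : 3 * r * (a + (1 + k₁ + (θ + K + K * ρ))) + b ≤ (n : ℝ) := by
      rw [hnt] at ha
      exact three_mul_add_le hr' (by positivity) ha (by linarith) hble
    exact_mod_cast h1
  · have h1 : 2 * ((q + 1) * L * k₁ ^ 2) + k₁ ≤ (b : ℝ) := by
      have h2 : (q : ℝ) + 1 ≤ 3 * (n / m) := by
        have : 1 ≤ (n : ℝ) / m := by rwa [le_div_iff₀ (by linarith), one_mul]
        linarith
      have h3 : 2 * (((q : ℝ) + 1) * L * k₁ ^ 2) ≤ 6 * (n / m) * (L * k₁ ^ 2) := by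
        have := mul_le_mul_of_nonneg_right h2 (show (0 : ℝ) ≤ L * k₁ ^ 2 by positivity)
        linarith
      have h4 : 6 * ((n : ℝ) / m) * (L * k₁ ^ 2) ≤ z * t / 2 := by
        rw [← hnt]
        have h5 : (L : ℝ) * k₁ ^ 2 ≤ m / (12 * t) := by
          rw [le_div_iff₀ (by positivity)]; linarith
        calc 6 * ((n : ℝ) / m) * (L * k₁ ^ 2) ≤ 6 * (n / m) * (m / (12 * t)) := by gcongr
          _ = n / t / 2 := by field_simp; ring
      linarith
    have h2 : 2 * ((q + 1) * L * k₁ ^ 2) + k₁ ≤ b := by exact_mod_cast h1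
    omega
  · have h1 : 2 * (q * M * K ^ 2) ≤ (β : ℝ) * θ := by
      have h2 : (q : ℝ) ≤ 2 * n := by
        have h3 : (n : ℝ) / m ≤ n := div_le_self (by positivity) hm'
        linarith
      calc 2 * ((q : ℝ) * M * K ^ 2) ≤ 2 * (2 * n * M * K ^ 2) := by gcongr
        _ = (β : ℝ) * (z / 8) := by rw [hβ', hnz]; ring
        _ ≤ (β : ℝ) * θ := by gcongr
    exact_mod_cast h1
  · have h1 : (β : ℝ) + K ≤ b := by linarith
    exact_mod_cast h1
  · have h1 : (0 : ℝ) < θ := by linarith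
    exact_mod_cast h1
  · push_cast
    have h1 : (1 / (t : ℝ)) ^ 2 * n = z := by rw [hz]; field_simp
    rw [h1]
    linarith

end Parameters

/-! ### The lemma itself -/

theorem exists_coloring {V : Type*} [Fintype V] (P : Finpartition (Finset.univ : Finset V)) {m : ℕ}
    (hP : ∀ S ∈ P.parts, S.card ≤ m) :
    ∃ c : V → ℕ, (∀ v, c v < P.parts.card) ∧
      (∀ i, (Finset.univ.filter fun v => c v = i).card ≤ m) ∧
      ∀ u v, c u = c v ↔ P.part u = P.part v := by
  have hpart : ∀ v, P.part v ∈ P.parts := fun v => P.part_mem.2 (Finset.mem_univ v)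
  refine ⟨fun v => P.parts.equivFin ⟨P.part v, hpart v⟩, fun v => Fin.is_lt _, fun i => ?_,
    fun u v => ?_⟩
  · by_cases h : ∃ v, (P.parts.equivFin ⟨P.part v, hpart v⟩ : ℕ) = i
    · obtain ⟨v, rfl⟩ := h
      refine (Finset.card_le_card fun u hu => ?_).trans (hP _ (hpart v))
      have hu := (Finset.mem_filter.1 hu).2
      have : P.part u = P.part v := by simpa [Fin.val_inj] using hu
      rw [← this]
      exact P.mem_part (Finset.mem_univ u)
    · push Not at h
      rw [Finset.filter_false_of_mem fun v _ => h v]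
      exact Nat.zero_le _
  · simp [Fin.val_inj]

end GraphDecomp

theorem lemma7p1 :
    ∃ n₀ : ℕ → ℕ, ∀ (r f : ℕ) (ε : ℝ), 1 ≤ r → 1 ≤ f → 0 < ε →
      ∃ m₀ : ℕ, ∀ m : ℕ, m₀ ≤ m → ∀ n : ℕ, n₀ m ≤ n →
        ∀ (W : Type*) [Fintype W] (F : SimpleGraph W),
          Fintype.card W = f → F.IsRegularOfDegree r →
        ∀ (V : Type*) [Fintype V] (G : SimpleGraph V), Fintype.card V = n →
        ∀ P : Finpartition (Finset.univ : Finset V),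
          P.IsEquipartition →
          P.parts.card = ⌈(n : ℝ) / (m : ℝ)⌉₊ →
          (∀ S ∈ P.parts, S.card = m ∨ S.card = m - 1) →
          (1 - 1 / (3 * (r : ℝ)) + ε) * (n : ℝ) ≤ ((GraphDecomp.crossing P G).minDegree : ℝ) →
          (∀ S ∈ P.parts, (1 - 1 / (3 * (r : ℝ)) + ε) * (S.card : ℝ) ≤
            ((G.induce (S : Set V)).minDegree : ℝ)) →
          ∃ A : SimpleGraph V, A ≤ G ∧ GraphDecomp.IsDivisible F A ∧
            ((GraphDecomp.crossing P A).maxDegree : ℝ) ≤ ε ^ 2 * (n : ℝ) ∧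
            (∀ S ∈ P.parts, (A.induce (S : Set V)).maxDegree ≤ r) ∧
            ∀ H : SimpleGraph V, GraphDecomp.IsDivisible F H →
              Disjoint A.edgeSet H.edgeSet →
              (GraphDecomp.crossing P H).edgeFinset.card = 0 →
              GraphDecomp.HasDecomposition F (A ⊔ H) := by
  -- The bound on `n` may depend on `m` alone, so it is a maximum over all `r`, `f` and `t` up to
  -- `m`, with `t` standing for `⌈1 / ε⌉₊`.
  refine ⟨fun m => (Finset.range (m + 1) ×ˢ (Finset.range (m + 1) ×ˢ Finset.range (m + 1))).sup
    fun p => GraphDecomp.sizeBound p.1 p.2.1 p.2.2 m, fun r f ε hr hf hε => ?_⟩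
  obtain ⟨t, htdef⟩ : ∃ t, t = ⌈1 / ε⌉₊ := ⟨_, rfl⟩
  have ht0 : 0 < t := htdef ▸ Nat.ceil_pos.2 (by positivity)
  have htε : 1 / (t : ℝ) ≤ ε := by
    have : 1 / ε ≤ t := htdef ▸ Nat.le_ceil _
    rw [div_le_iff₀ hε] at this
    rw [div_le_iff₀ (by exact_mod_cast ht0)]
    linarith
  -- The first three summands put `r`, `f` and `t` in the range of that maximum; the last is what
  -- leaves room for the carriers.
  refine ⟨r + f + t + 12 * t * (r * f * (1 + r * f) ^ 2), ?_⟩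
  intro m hm n hn W _ F hW hF V _ G hV P _ hq hS hcross _
  have hsize : GraphDecomp.sizeBound r f t m ≤ n := by
    refine le_trans (Finset.le_sup (f := fun p : ℕ × ℕ × ℕ =>
      GraphDecomp.sizeBound p.1 p.2.1 p.2.2 m) (b := (r, f, t)) ?_) hn
    simp only [Finset.mem_product, Finset.mem_range]
    omega
  have hWn : Nonempty W := Fintype.card_pos_iff.1 (by omega)
  obtain ⟨c, hc, hcm, hcP⟩ := GraphDecomp.exists_coloring P (m := m) (fun S h => by
    rcases hS S h with h | h <;> omega)
  obtain ⟨G₀, hG₀⟩ : ∃ G₀, G₀ = GraphDecomp.crossing P G := ⟨_, rfl⟩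
  rw [← hG₀] at hcross
  have hminle : G₀.minDegree ≤ n := by
    have : Nonempty V := Fintype.card_pos_iff.1 (by
      rw [hV]
      refine lt_of_lt_of_le ?_ hsize
      unfold GraphDecomp.sizeBound
      positivity)
    obtain ⟨v⟩ := this
    have h1 := G₀.minDegree_le_degree v
    have h2 := G₀.degree_lt_card_verts v
    omega
  obtain ⟨θ, β₁, β, b, h₁, h₂, h₃, h₄, h₅, h₆, h₇⟩ := GraphDecomp.exists_parameters
    (r := r) (L := r * f) (t := t) (k₁ := 1 + r * f) (K := GraphDecomp.gadgetBound r f m)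
    (M := GraphDecomp.taskBound m (r * f)) (ρ := GraphDecomp.rootBound m (r * f)) (m := m) (n := n)
    (q := P.parts.card) (a := n - G₀.minDegree) hr ht0 (by omega) (by omega) hsize
    (by rw [hq]; exact (Nat.ceil_lt_add_one (by positivity)).le)
    (by
      rw [Nat.cast_sub hminle]
      have h1 : (n : ℝ) / t ≤ ε * n := by
        rw [div_eq_mul_one_div, mul_comm]
        gcongr
      have h2 : (1 - 1 / (3 * (r : ℝ)) + ε) * n = n - n / (3 * r) + ε * n := by ring
      linarith)
  obtain ⟨A, hAG, hAd, hAdeg, hAH⟩ := GraphDecomp.exists_absorbing_graph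
    (G := G₀) (a := n - G₀.minDegree)
    (β₁ := β₁) (b := b) (θ := θ) (β := β)
    hF hr hc hcm
    (fun u v h => by
      rw [hG₀] at h
      exact fun hh => h.2 ((hcP u v).1 hh)) (L := r * f) (by rw [hW]) rfl rfl rfl
    (by rw [hW]; rfl) rfl rfl
    (fun v => by
      have := G₀.minDegree_le_degree v
      omega) (hV.symm ▸ h₁) h₂ h₃ h₄ h₅ h₆
  have hAcross : ∀ u v, A.Adj u v → G.Adj u v ∧ P.part u ≠ P.part v := fun u v h => by
    have := hAG h
    rwa [hG₀] at this
  refine ⟨A, fun u v h => (hAcross u v h).1, hAd, ?_, ?_, ?_⟩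
  · have hle : GraphDecomp.crossing P A ≤ A := fun u v h => h.1
    have h1 : (GraphDecomp.crossing P A).maxDegree ≤ _ :=
      SimpleGraph.maxDegree_le_of_forall_degree_le _ _ fun v =>
        (SimpleGraph.degree_le_of_le hle).trans (hAdeg v)
    refine (Nat.cast_le.2 h1).trans (h₇.trans ?_)
    gcongr
  -- Every edge of `A` crosses between parts, so the degrees inside a part are `0`.
  · intro S hS
    refine SimpleGraph.maxDegree_le_of_forall_degree_le _ _ fun v => ?_
    rw [(SimpleGraph.degree_eq_zero _ _).2]
    · exact Nat.zero_le _
    · intro u huv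
      refine (hAcross _ _ huv).2 ?_
      exact (P.part_eq_of_mem hS v.2).trans (P.part_eq_of_mem hS u.2).symm
  · intro H hH _ hHc
    refine hAH H hH fun u v huv => (hcP u v).2 ?_
    by_contra hne
    rw [Finset.card_eq_zero] at hHc
    have : s(u, v) ∈ (GraphDecomp.crossing P H).edgeFinset :=
      SimpleGraph.mem_edgeFinset.2 ⟨huv, hne⟩
    rw [hHc] at this
    exact Finset.notMem_empty _ this
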